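/- Null-form estimates for free Dirac waves. Notation. Let $m\ge 0$, $\langle\xi\rangle_m=\sqrt{m^2+|\xi|^2}$ and $\widehat f(\xi)=\mathcal F_x f(\xi)=\int_{\mathbb R^3}e^{-ix\cdot\xi}f(x)\,dx$. For $t\in\mathbb R$ let $S_m(t)=e^{-it\langle D\rangle_m}$, i.e. $\widehat{S_m(t)f}(\xi)=e^{-it\langle\xi\rangle_m}\widehat f(\xi)$. Fix an even $\chi\in C_0^\infty((-2,2))$ with $\chi=1$ on $[-1,1]$; put $\rho_1=\chi$, $\rho_\lambda(s)=\chi(s/\lambda)-\chi(2s/\lambda)$ for $\lambda>1$, $P_\lambda f=\mathcal F_x^{-1}[\rho_\lambda(|\xi|)\widehat f(\xi)]$ and $f_\lambda=P_\lambda f$. Let $\sigma^1,\sigma^2,\sigma^3$ be the Pauli matrices, $$\beta=\begin{pmatrix}I&0\\0&-I\end{pmatrix},\qquad \alpha^j=\begin{pmatrix}0&\sigma^j\\ \sigma^j&0\end{pmatrix},\qquad S^l=\begin{pmatrix}\sigma^l&0\\0&\sigma^l\end{pmatrix},$$ write $\hat\eta=\langle\eta\rangle_m^{-1}\eta$ for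 a frequency $\eta\in\mathbb R^3$, and set $$q_1^\pm(\eta,\zeta)=(|\hat\eta||\hat\zeta|\mp\hat\eta\cdot\hat\zeta)I,\qquad q_2^\pm(\eta,\zeta)=-(\hat\eta|\hat\zeta|\mp\hat\zeta|\hat\eta|)\cdot\boldsymbol\alpha,\qquad q_3^\pm(\eta,\zeta)=\mp i(\hat\eta\times\hat\zeta)\cdot S .$$ With $\langle v,w\rangle=w^\dagger v$ on $\mathbb C^4$, define the bilinear forms $$Q_j(\psi^+,\psi^\pm)=\mathcal F_x^{-1}\left[\int_{\mathbb R^3}\big\langle\beta\widehat{\psi^+}(\eta),\,q_j^\pm(\eta,\eta-\xi)\,\widehat{\psi^\pm}(\eta-\xi)\big\rangle\,d\eta\right],\qquad j=1,2,3,$$ where the symbol $q_j^+$ is used when the second argument is $S_m(t)g$ and $q_j^-$ when it is $S_m(-t)g$. The norm $\|\cdot\|$ is that of $L^2_{t,x}(\mathbb R^{1+3})$ for functions of $(t,x)$ and that of $L^2_x(\mathbb R^3)$ for functions of $x$. Statement. Let $m\ge0$, let $\chi$ be as above and let $K>1$. There is a constant $C>0$, depending only on $m$, $\chi$ and $K$,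 such that for all dyadic numbers $\mu,\lambda_1,\lambda_2\ge1$ (of the form $2^k$, $k\in\mathbb Z$), all $j\in\{1,2,3\}$ and all $f,g\in L^2(\mathbb R^3;\mathbb C^4)$ the functions below belong to $L^2_{t,x}$ and satisfy the following bounds. Here $\mu\lesssim\lambda_1$ means $\mu\le K\lambda_1$, $\lambda_1\sim\lambda_2$ means $K^{-1}\lambda_2\le\lambda_1\le K\lambda_2$, and $\lambda_1\nsim\lambda_2$ means $\lambda_1\le K^{-1}\lambda_2$ or $\lambda_2\le K^{-1}\lambda_1$. (i) (++) interaction: $$\|P_\mu Q_j(S_m(t)f_{\lambda_1},S_m(t)g_{\lambda_2})\|\le C\begin{cases}(\lambda_1\wedge\lambda_2)\,\|f_{\lambda_1}\|\|g_{\lambda_2}\|&\text{if }\lambda_1\nsim\lambda_2,\\ \mu\,(\mu/\lambda_1)^{1/2}\,\|f_{\lambda_1}\|\|g_{\lambda_2}\|&\text{if }\mu\lesssim\lambda_1\sim\lambda_2.\end{cases}$$ (ii) (+-) interaction: $$\|P_\mu Q_j(S_m(t)f_{\lambda_1},S_m(-t)g_{\lambda_2})\|\le C\begin{cases}(\lambda_1\wedge\lambda_2)\,\|f_{\lambda_1}\|\|g_{\lambda_2}\|&\text{if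 }\lambda_1\nsim\lambda_2,\\ \mu\,\|f_{\lambda_1}\|\|g_{\lambda_2}\|&\text{if }\mu\lesssim\lambda_1\sim\lambda_2.\end{cases}$$ -/

import Mathlib

open MeasureTheory
open scoped ContDiff FourierTransform Matrix

noncomputable section

namespace DiracNull

/-- Physical (and frequency) space `ℝ³` with the Euclidean norm. -/
abbrev E3 : Type := EuclideanSpace ℝ (Fin 3)

/-- The spinor space `ℂ⁴`, written in `2 + 2` blocks. -/
abbrev Spinor : Type := EuclideanSpace ℂ (Fin 2 ⊕ Fin 2)

/-- `4 × 4` complex matrices, in `2 + 2` blocks. -/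
abbrev Mat4 : Type := Matrix (Fin 2 ⊕ Fin 2) (Fin 2 ⊕ Fin 2) ℂ

/-- The space `L²(ℝ³; ℂ⁴)`. -/
abbrev L2 : Type := Lp (α := E3) Spinor 2

/-! ### Dirac matrices -/

/-- The Pauli matrices `σ¹, σ², σ³`. -/
def pauli : Fin 3 → Matrix (Fin 2) (Fin 2) ℂ :=
  ![!![0, 1; 1, 0], !![0, -Complex.I; Complex.I, 0], !![1, 0; 0, -1]]

/-- `β = γ⁰`. -/
def beta : Mat4 := Matrix.fromBlocks 1 0 0 (-1)

/-- `γʲ`. -/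
def gamma (j : Fin 3) : Mat4 := Matrix.fromBlocks 0 (pauli j) (-pauli j) 0

/-- `αʲ = γ⁰ γʲ`. -/
def alpha (j : Fin 3) : Mat4 := beta * gamma j

/-- `Sˡ = diag(σˡ, σˡ)`. -/
def spin (l : Fin 3) : Mat4 := Matrix.fromBlocks (pauli l) 0 0 (pauli l)

/-- `v · M = ∑ₖ vₖ Mᵏ` for a real vector `v` and a triple `M` of matrices. -/
def vecDot (v : Fin 3 → ℝ) (M : Fin 3 → Mat4) : Mat4 := ∑ k, (v k : ℂ) • M k

/-! ### Fourier transform, Fourier multipliers -/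

/-- The (Plancherel) Fourier transform with the normalization
`f̂(ξ) = ∫ e^{-i x·ξ} f(x) dx`, obtained by rescaling Mathlib's transform. -/
def hat (f : L2) (ξ : E3) : Spinor := (𝓕 f : L2) ((2 * Real.pi)⁻¹ • ξ)

/-- The inverse Fourier transform `(2π)⁻³ ∫ e^{i x·ξ} G(ξ) dξ` of an integrable function. -/
def invFourier (G : E3 → ℂ) (x : E3) : ℂ :=
  ((2 * Real.pi : ℝ) : ℂ)⁻¹ ^ 3 *
    ∫ ξ : E3, Complex.exp (Complex.I * ((inner ℝ x ξ : ℝ) : ℂ)) * G ξ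

theorem memLp_multiplier (a : E3 → ℂ) (ha : Measurable a) (hb : ∃ C : ℝ, ∀ ξ, ‖a ξ‖ ≤ C)
    (f : L2) : MemLp (fun ξ : E3 => a ((2 * Real.pi) • ξ) • (f : E3 → Spinor) ξ) 2 volume := by
  obtain ⟨C, hC⟩ := hb
  refine MemLp.of_le_mul (c := C) (Lp.memLp f) ?_ ?_
  · exact ((ha.comp (measurable_const_smul (2 * Real.pi))).aestronglyMeasurable).smul
      (Lp.aestronglyMeasurable f)
  · refine Filter.Eventually.of_forall fun ξ => ?_
    rw [norm_smul]
    exact mul_le_mul_of_nonneg_right (hC _) (norm_nonneg _)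

/-- The Fourier multiplier on `L²(ℝ³; ℂ⁴)` with bounded measurable symbol `a`:
the transform of `a(D) f` is `a(ξ) f̂(ξ)` in the normalization of `hat`. -/
def fourierMultiplier (a : E3 → ℂ) (ha : Measurable a) (hb : ∃ C : ℝ, ∀ ξ, ‖a ξ‖ ≤ C)
    (f : L2) : L2 :=
  𝓕⁻ ((memLp_multiplier a ha hb (𝓕 f : L2)).toLp _)

/-! ### Frequency projections -/

/-- An even cutoff `χ ∈ C₀^∞((-2, 2))` with `χ = 1` on `[-1, 1]`. -/
structure Cutoff where
  toFun : ℝ → ℝ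
  contDiff : ContDiff ℝ ∞ toFun
  even : ∀ s, toFun (-s) = toFun s
  tsupport_subset : tsupport toFun ⊆ Set.Ioo (-2) 2
  eq_one : ∀ s, |s| ≤ 1 → toFun s = 1

/-- The dyadic cutoffs `ρ_l`. -/
def rho (χ : Cutoff) (l s : ℝ) : ℝ :=
  if l < 1 then 0
  else if l = 1 then χ.toFun s
  else χ.toFun (s / l) - χ.toFun (2 * s / l)

theorem Cutoff.bounded (χ : Cutoff) : ∃ C : ℝ, ∀ s, ‖χ.toFun s‖ ≤ C := by
  have hc : HasCompactSupport χ.toFun :=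
    isCompact_Icc.of_isClosed_subset (isClosed_tsupport _)
      (χ.tsupport_subset.trans (Set.Ioo_subset_Icc_self (a := (-2 : ℝ)) (b := 2)))
  exact hc.exists_bound_of_continuous χ.contDiff.continuous

theorem measurable_rho_norm (χ : Cutoff) (l : ℝ) :
    Measurable fun ξ : E3 => ((rho χ l ‖ξ‖ : ℝ) : ℂ) := by
  have hχ : Measurable χ.toFun := χ.contDiff.continuous.measurable
  have h : Measurable (rho χ l) := by
    unfold rho
    split_ifs
    · exact measurable_const
    · exact hχ
    · exact (hχ.comp (measurable_id.div_const l)).sub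
        (hχ.comp ((measurable_id.const_mul 2).div_const l))
  exact Complex.measurable_ofReal.comp (h.comp measurable_norm)

theorem bounded_rho_norm (χ : Cutoff) (l : ℝ) :
    ∃ C : ℝ, ∀ ξ : E3, ‖((rho χ l ‖ξ‖ : ℝ) : ℂ)‖ ≤ C := by
  obtain ⟨C, hC⟩ := χ.bounded
  have h0 : 0 ≤ C := (norm_nonneg _).trans (hC 0)
  refine ⟨C + C, fun ξ => ?_⟩
  rw [Complex.norm_real]
  unfold rho
  split_ifs
  · simpa using add_nonneg h0 h0
  · exact (hC _).trans (by linarith)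
  · exact (norm_sub_le _ _).trans (add_le_add (hC _) (hC _))

/-- The frequency projection `P_l f = F⁻¹[ρ_l(|ξ|) f̂(ξ)]` on `L²(ℝ³; ℂ⁴)`. -/
def freqProj (χ : Cutoff) (l : ℝ) (f : L2) : L2 :=
  fourierMultiplier _ (measurable_rho_norm χ l) (bounded_rho_norm χ l) f

/-! ### Free waves -/

/-- `⟨ξ⟩_m = √(m² + |ξ|²)`. -/
def bracket (m : ℝ) (ξ : E3) : ℝ := Real.sqrt (m ^ 2 + ‖ξ‖ ^ 2)

/-- The symbol `e^{-i t ⟨ξ⟩_m}`. -/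
def propagatorSymbol (m t : ℝ) (ξ : E3) : ℂ :=
  Complex.exp (-Complex.I * ((t * bracket m ξ : ℝ) : ℂ))

theorem measurable_propagatorSymbol (m t : ℝ) : Measurable (propagatorSymbol m t) := by
  unfold propagatorSymbol bracket
  fun_prop

theorem bounded_propagatorSymbol (m t : ℝ) : ∃ C : ℝ, ∀ ξ, ‖propagatorSymbol m t ξ‖ ≤ C :=
  ⟨1, fun ξ => by simp [propagatorSymbol, Complex.norm_exp]⟩

/-- The propagator `S_m(t) = e^{-i t ⟨D⟩_m}`, `t ∈ ℝ`; so `S_m(-t) = e^{+i t ⟨D⟩_m}`. -/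
def propagator (m t : ℝ) (f : L2) : L2 :=
  fourierMultiplier _ (measurable_propagatorSymbol m t) (bounded_propagatorSymbol m t) f

/-! ### Null forms -/

/-- The normalized frequency `ξ / ⟨ξ⟩_m`. -/
def unitFreq (m : ℝ) (ξ : E3) : E3 := (bracket m ξ)⁻¹ • ξ

/-- The null symbols `q₁^ε, q₂^ε, q₃^ε` (indexed by `j = 0, 1, 2`); the sign `ε` is `1` or `-1`.
With `a = η/⟨η⟩_m` and `b = ζ/⟨ζ⟩_m` they are
`(|a||b| - ε a·b) I`, `-(|b| a - ε |a| b)·α` and `-ε i (a × b)·S`. -/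
def nullSymbol (m ε : ℝ) (j : Fin 3) (η ζ : E3) : Mat4 :=
  let a := unitFreq m η
  let b := unitFreq m ζ
  ![((‖a‖ * ‖b‖ - ε * inner ℝ a b : ℝ) : ℂ) • (1 : Mat4),
    -vecDot (fun k => a k * ‖b‖ - ε * (b k * ‖a‖)) alpha,
    (-(ε : ℂ) * Complex.I) • vecDot (crossProduct (fun k => a k) (fun k => b k)) spin] j

/-- The inner product of `ℂ⁴`, linear in the first and antilinear in the second argument:
`⟨v, w⟩ = w† v`. -/
def spinorInner (v w : Fin 2 ⊕ Fin 2 → ℂ) : ℂ := v ⬝ᵥ star w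

/-- The spatial Fourier transform of the null form `Q_j(ψ, φ)` (with symbol `q_j^ε`):
`∬_{ξ = η - ζ} ⟨β ψ̂(η), q_j^ε(η, ζ) φ̂(ζ)⟩ dη dζ`, that is, the integral over `η` with
`ζ = η - ξ`. For `ψ, φ ∈ L²` it converges absolutely for every `ξ` and is bounded in `ξ`. -/
def nullFormHat (m ε : ℝ) (j : Fin 3) (ψ φ : L2) (ξ : E3) : ℂ :=
  ∫ η : E3, spinorInner (beta *ᵥ (hat ψ η).ofLp)
    (nullSymbol m ε j η (η - ξ) *ᵥ (hat φ (η - ξ)).ofLp)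

/-- `P_μ Q_j(ψ, φ) = F⁻¹[ρ_μ(|ξ|) F[Q_j(ψ, φ)](ξ)]`; for `ψ, φ ∈ L²` the function in the
bracket is bounded with compact support, so that `F⁻¹` is an absolutely convergent integral. -/
def projNullForm (χ : Cutoff) (m ε μ : ℝ) (j : Fin 3) (ψ φ : L2) : E3 → ℂ :=
  invFourier fun ξ => ((rho χ μ ‖ξ‖ : ℝ) : ℂ) * nullFormHat m ε j ψ φ ξ

/-- The space-time function `P_μ Q_j(S_m(t) f, S_m(ε t) g)` of `(t, x) ∈ ℝ × ℝ³`: the (++)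
interaction for `ε = 1`, the (+-) interaction for `ε = -1`. -/
def waveNullForm (χ : Cutoff) (m ε μ : ℝ) (j : Fin 3) (f g : L2) (p : ℝ × E3) : ℂ :=
  projNullForm χ m ε μ j (propagator m p.1 f) (propagator m (ε * p.1) g) p.2

/-- `u ∈ L²_{t,x}(ℝ^{1+3})` with `‖u‖ ≤ B`. -/
def L2Bound (u : ℝ × E3 → ℂ) (B : ℝ) : Prop :=
  MemLp u 2 volume ∧ eLpNorm u 2 volume ≤ ENNReal.ofReal B

/-- Dyadic numbers `2^k`, `k ∈ ℤ`. -/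
def IsDyadic (l : ℝ) : Prop := ∃ k : ℤ, l = (2 : ℝ) ^ k

/-- `A ≲ B` with implicit constant `K`. -/
def Lesssim (K A B : ℝ) : Prop := A ≤ K * B

/-- `A ∼ B` with implicit constant `K`. -/
def Comparable (K A B : ℝ) : Prop := Lesssim K A B ∧ Lesssim K B A

/-- `A ≁ B` with implicit constant `K`: `A ≤ K⁻¹ B` or `B ≤ K⁻¹ A`. -/
def NotComparable (K A B : ℝ) : Prop := A ≤ K⁻¹ * B ∨ B ≤ K⁻¹ * A

end DiracNull

end

/-!
On the Fourier side the null form is the oscillatory integral `∫ e^{-itφ(η)} a(η) dη` with phase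
`φ(η) = ⟨η⟩_m - ε ⟨η - ξ⟩_m`, where `ε = 1` for the `(++)` and `ε = -1` for the `(+-)` interaction.
All three squared null symbols are dominated by the angular quantity `|η̂| |ζ̂| - ε η̂ · ζ̂` at
`ζ = η - ξ`, which in turn is at most `|∇φ|² / 2`. Hence `|a|²` carries a factor `|∇φ|`. By
Plancherel in `t` and Cauchy–Schwarz, the `L²` norm in `t` is controlled by the density of the
push-forward of `|∇φ| dη` under `φ`. On a cube of side `R` this density is `O(R²)`, because on
every line parallel to a coordinate axis `φ` is monotone on at most two intervals.

Taking for `R` the smaller input frequency gives the bound by `λ₁ ∧ λ₂`. Splitting the inputs into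
cells of side `μ`, which interact almost orthogonally, gives the bound by `μ`. In the `(++)` case
the angular quantity is `O(μ² / (λ₁ λ₂))`, and its square root, of size `μ / λ₁`, is a gain in the
estimate for `|a|²`.
-/

noncomputable section

namespace DiracNull

theorem eLpNorm_two_sq {X F : Type*} [MeasurableSpace X] [NormedAddCommGroup F] (f : X → F)
    (ν : Measure X) : eLpNorm f 2 ν ^ 2 = ∫⁻ x, ‖f x‖ₑ ^ 2 ∂ν := by
  simpa using eLpNorm_nnreal_pow_eq_lintegral (p := 2) (f := f) (μ := ν) two_ne_zero

section Plancherel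

variable {V : Type*} [NormedAddCommGroup V] [InnerProductSpace ℝ V] [FiniteDimensional ℝ V]
  [MeasurableSpace V] [BorelSpace V]

theorem fourier_toLp_ae_eq {a : V → ℂ} (h1 : Integrable a) (h2 : MemLp a 2 volume) :
    ((𝓕 (h2.toLp a) : Lp (α := V) ℂ 2 volume) : V → ℂ) =ᵐ[volume] 𝓕 a := by
  have hcont : Continuous (𝓕 a) :=
    VectorFourier.fourierIntegral_continuous Real.continuous_fourierChar
      (by exact continuous_inner) h1
  -- both sides define the same tempered distribution, so they agree against test functions
  refine ae_eq_of_integral_contDiff_smul_eq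
    ((Lp.memLp _).locallyIntegrable (by norm_num)) hcont.locallyIntegrable fun g hg hgc => ?_
  have hg₁ : HasCompactSupport (Complex.ofRealCLM ∘ g) := hgc.comp_left rfl
  have hg₂ : ContDiff ℝ ∞ (Complex.ofRealCLM ∘ g) := by fun_prop
  set G : SchwartzMap V ℂ := hg₁.toSchwartzMap hg₂ with hG
  have hGg : ∀ (u : V → ℂ) (x : V), g x • u x = G x • u x := fun u x => by simp [hG]
  have hdistr := DFunLike.congr_fun (Lp.fourier_toTemperedDistribution_eq (h2.toLp a)) G
  rw [TemperedDistribution.fourier_apply, Lp.toTemperedDistribution_apply,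
    Lp.toTemperedDistribution_apply] at hdistr
  have hflip : ∫ x, (𝓕 (G : V → ℂ)) x • a x = ∫ x, G x • 𝓕 a x := by
    simpa using! (VectorFourier.integral_fourierIntegral_smul_eq_flip (L := innerₗ V)
      Real.continuous_fourierChar continuous_inner G.integrable h1)
  calc ∫ x, g x • (𝓕 (h2.toLp a) : Lp (α := V) ℂ 2 volume) x
      = ∫ x, (𝓕 G) x • h2.toLp a x := by simp only [hGg, hdistr]
    _ = ∫ x, (𝓕 G) x • a x :=
        integral_congr_ae (by filter_upwards [h2.coeFn_toLp] with x hx; rw [hx])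
    _ = ∫ x, g x • 𝓕 a x := by simp only [hGg, ← hflip, SchwartzMap.fourier_coe]

theorem lintegral_enorm_fourier_sq {a : V → ℂ} (h1 : Integrable a) (h2 : MemLp a 2 volume) :
    ∫⁻ ξ, ‖𝓕 a ξ‖ₑ ^ 2 = ∫⁻ x, ‖a x‖ₑ ^ 2 := by
  have h : eLpNorm (𝓕 a) 2 volume = eLpNorm a 2 volume := by
    rw [← eLpNorm_congr_ae (fourier_toLp_ae_eq h1 h2), ← eLpNorm_congr_ae h2.coeFn_toLp,
      ← Lp.enorm_def, ← Lp.enorm_def, ← ofReal_norm, ← ofReal_norm, Lp.norm_fourier_eq]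
  rw [← eLpNorm_two_sq, ← eLpNorm_two_sq, h]

theorem lintegral_comp_inv_smul {r : ℝ} (hr : 0 < r) (f : V → ENNReal) :
    ∫⁻ x, f (r⁻¹ • x) = ENNReal.ofReal (r ^ Module.finrank ℝ V) * ∫⁻ x, f x := by
  have hm : MeasurableEmbedding fun x : V => r⁻¹ • x :=
    (Homeomorph.smulOfNeZero r⁻¹ (inv_ne_zero hr.ne')).measurableEmbedding
  rw [← hm.lintegral_map, Measure.map_addHaar_smul _ (inv_ne_zero hr.ne'), lintegral_smul_measure]
  congr 2
  rw [inv_pow, inv_inv, abs_of_pos (by positivity)]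

theorem lintegral_enorm_integral_exp_neg_inner_sq {a : V → ℂ} (h1 : Integrable a)
    (h2 : MemLp a 2 volume) :
    ∫⁻ ξ, ‖∫ x, Complex.exp (-Complex.I * ((inner ℝ ξ x : ℝ) : ℂ)) * a x‖ₑ ^ 2 =
      ENNReal.ofReal ((2 * Real.pi) ^ Module.finrank ℝ V) * ∫⁻ x, ‖a x‖ₑ ^ 2 := by
  rw [← lintegral_enorm_fourier_sq h1 h2, ← lintegral_comp_inv_smul Real.two_pi_pos]
  refine lintegral_congr fun ξ => ?_
  congr 2
  rw [Real.fourier_eq']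
  refine integral_congr_ae (Filter.Eventually.of_forall fun x => ?_)
  simp only [smul_eq_mul]
  congr 2
  rw [inner_smul_right, real_inner_comm]
  push_cast
  have : (Real.pi : ℂ) ≠ 0 := by exact_mod_cast Real.pi_ne_zero
  field_simp

theorem lintegral_enorm_integral_exp_inner_sq {a : V → ℂ} (h1 : Integrable a)
    (h2 : MemLp a 2 volume) :
    ∫⁻ ξ, ‖∫ x, Complex.exp (Complex.I * ((inner ℝ ξ x : ℝ) : ℂ)) * a x‖ₑ ^ 2 =
      ENNReal.ofReal ((2 * Real.pi) ^ Module.finrank ℝ V) * ∫⁻ x, ‖a x‖ₑ ^ 2 := by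
  rw [← lintegral_enorm_integral_exp_neg_inner_sq h1 h2, ← lintegral_neg_eq_self]
  simp

end Plancherel

section Duality

variable {X : Type*} [MeasurableSpace X] {ν : Measure X}

theorem lintegral_sq_le_of_sq_le_mul {h u v : X → ENNReal} (hu : AEMeasurable u ν)
    (hv : AEMeasurable v ν) (hh : ∀ x, h x ^ 2 ≤ u x * v x) :
    (∫⁻ x, h x ∂ν) ^ 2 ≤ (∫⁻ x, u x ∂ν) * ∫⁻ x, v x ∂ν := by
  have hsq : ∀ y : ENNReal, (y ^ (1 / 2 : ℝ)) ^ (2 : ℝ) = y := fun y => by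
    rw [← ENNReal.rpow_mul]; norm_num
  have hle : ∀ x, h x ≤ u x ^ (1 / 2 : ℝ) * v x ^ (1 / 2 : ℝ) := fun x => by
    rw [← ENNReal.mul_rpow_of_nonneg _ _ (by norm_num)]
    calc h x = (h x ^ 2) ^ (1 / 2 : ℝ) := by
          rw [← ENNReal.rpow_natCast, ← ENNReal.rpow_mul]; norm_num
      _ ≤ _ := ENNReal.rpow_le_rpow (hh x) (by norm_num)
  have hHolder := ENNReal.lintegral_mul_le_Lp_mul_Lq ν Real.HolderConjugate.two_two
    (hu.pow_const (1 / 2 : ℝ)) (hv.pow_const (1 / 2 : ℝ))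
  simp only [hsq, Pi.mul_apply] at hHolder
  calc (∫⁻ x, h x ∂ν) ^ 2
      ≤ ((∫⁻ x, u x ∂ν) ^ (1 / 2 : ℝ) * (∫⁻ x, v x ∂ν) ^ (1 / 2 : ℝ)) ^ 2 := by
        gcongr
        exact (lintegral_mono hle).trans hHolder
    _ = _ := by
        rw [mul_pow, ← ENNReal.rpow_natCast, ← ENNReal.rpow_natCast]
        push_cast
        rw [hsq, hsq]

theorem enorm_integral_norm_sq {a : X → ℂ} (ha : MemLp a 2 ν) :
    ‖∫ x, ((‖a x‖ ^ 2 : ℝ) : ℂ) ∂ν‖ₑ = ∫⁻ x, ‖a x‖ₑ ^ 2 ∂ν := by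
  have h0 : 0 ≤ ∫ x, ‖a x‖ ^ 2 ∂ν := integral_nonneg fun x => by positivity
  rw [integral_complex_ofReal, ← ofReal_norm, Complex.norm_real, Real.norm_of_nonneg h0,
    ofReal_integral_eq_lintegral_ofReal ((memLp_two_iff_integrable_sq_norm ha.1).1 ha)
      (Filter.Eventually.of_forall fun x => by positivity)]
  simp only [ENNReal.ofReal_pow (norm_nonneg _), ofReal_norm]

theorem memLp_indicator_of_bound {F : Type*} [NormedAddCommGroup F] {f : X → F}
    (hf : AEStronglyMeasurable f ν) {s : Set X} (hs : MeasurableSet s) (hνs : ν s ≠ ⊤) {B : ℝ}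
    (hB : ∀ x ∈ s, ‖f x‖ ≤ B) (p : ENNReal) : MemLp (s.indicator f) p ν := by
  have : Fact (ν s < ⊤) := ⟨hνs.lt_top⟩
  exact (memLp_indicator_iff_restrict hs).2
    (MemLp.of_bound hf.restrict B ((ae_restrict_mem hs).mono hB))

theorem setLIntegral_enorm_sq_le_of_forall_enorm_integral_mul_sq_le {V : X → ℂ}
    (hV : Measurable V) {C : ENNReal}
    (hC : ∀ a : X → ℂ, Integrable a ν → MemLp a 2 ν →
      ‖∫ x, a x * V x ∂ν‖ₑ ^ 2 ≤ C * ∫⁻ x, ‖a x‖ₑ ^ 2 ∂ν)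
    {s : Set X} (hs : MeasurableSet s) (hνs : ν s ≠ ⊤) {B : ℝ} (hB : ∀ x ∈ s, ‖V x‖ ≤ B) :
    ∫⁻ x in s, ‖V x‖ₑ ^ 2 ∂ν ≤ C := by
  set a : X → ℂ := s.indicator (fun x => star (V x)) with ha
  have haLp : ∀ p : ENNReal, MemLp a p ν :=
    memLp_indicator_of_bound (continuous_star.measurable.comp hV).aestronglyMeasurable hs hνs
      fun x hx => by simpa using hB x hx
  have hmul : ∀ x, a x * V x = ((‖a x‖ ^ 2 : ℝ) : ℂ) := fun x => by
    by_cases hx : x ∈ s <;> simp [ha, hx, Complex.conj_mul']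
  set A : ENNReal := ∫⁻ x, ‖a x‖ₑ ^ 2 ∂ν with hA
  have hAs : ∫⁻ x in s, ‖V x‖ₑ ^ 2 ∂ν = A := by
    rw [hA, ← lintegral_indicator hs]
    refine lintegral_congr fun x => ?_
    by_cases hx : x ∈ s <;> simp [ha, hx]
  have hAC : A * A ≤ C * A := by
    have h := hC a (memLp_one_iff_integrable.1 (haLp 1)) (haLp 2)
    rwa [integral_congr_ae (Filter.Eventually.of_forall hmul), enorm_integral_norm_sq (haLp 2),
      sq] at h
  have hAtop : A ≠ ⊤ := by
    rw [hA, ← eLpNorm_two_sq]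
    exact ENNReal.pow_ne_top (haLp 2).2.ne
  rw [hAs]
  rcases eq_or_ne A 0 with h0 | h0
  · exact h0.le.trans zero_le
  · exact (ENNReal.mul_le_mul_iff_left h0 hAtop).1 hAC

theorem lintegral_enorm_sq_le_of_forall_enorm_integral_mul_sq_le [SigmaFinite ν] {V : X → ℂ}
    (hV : Measurable V) {C : ENNReal}
    (hC : ∀ a : X → ℂ, Integrable a ν → MemLp a 2 ν →
      ‖∫ x, a x * V x ∂ν‖ₑ ^ 2 ≤ C * ∫⁻ x, ‖a x‖ₑ ^ 2 ∂ν) :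
    ∫⁻ x, ‖V x‖ₑ ^ 2 ∂ν ≤ C := by
  set s : ℕ → Set X := fun n => spanningSets ν n ∩ {x | ‖V x‖ ≤ n}
  have hs : ∀ n, MeasurableSet (s n) := fun n =>
    (measurableSet_spanningSets ν n).inter (measurableSet_le hV.norm measurable_const)
  have hmono : Monotone s := fun i j hij =>
    Set.inter_subset_inter (monotone_spanningSets ν hij)
      fun x (hx : ‖V x‖ ≤ i) => hx.trans (by exact_mod_cast hij)
  have hunion : ⋃ n, s n = Set.univ := Set.eq_univ_of_forall fun x => by
    obtain ⟨n, hn⟩ := exists_nat_ge ‖V x‖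
    refine Set.mem_iUnion.2 ⟨max (spanningSetsIndex ν x) n, ?_, hn.trans (by simp)⟩
    exact monotone_spanningSets ν (le_max_left _ _) (mem_spanningSetsIndex ν x)
  calc ∫⁻ x, ‖V x‖ₑ ^ 2 ∂ν = ⨆ n, ∫⁻ x in s n, ‖V x‖ₑ ^ 2 ∂ν := by
        rw [← setLIntegral_iUnion_of_directed _ hmono.directed_le, hunion, setLIntegral_univ]
    _ ≤ C := iSup_le fun n => setLIntegral_enorm_sq_le_of_forall_enorm_integral_mul_sq_le hV hC
        (hs n) ((measure_mono Set.inter_subset_left).trans_lt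
          (measure_spanningSets_lt_top ν n)).ne fun _ hx => hx.2

end Duality

section Oscillatory

variable {X : Type*} [MeasurableSpace X] {ν : Measure X}

theorem lintegral_mul_comp_le_of_setLIntegral_preimage_le {φ : X → ℝ} (hφ : Measurable φ)
    {w : X → ENNReal} (hw : Measurable w) {M : ENNReal}
    (hpush : ∀ S : Set ℝ, MeasurableSet S → ∫⁻ x in φ ⁻¹' S, w x ∂ν ≤ M * volume S)
    {p : ℝ → ENNReal} (hp : Measurable p) :
    ∫⁻ x, w x * p (φ x) ∂ν ≤ M * ∫⁻ τ, p τ := by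
  have hle : (ν.withDensity w).map φ ≤ M • (volume : Measure ℝ) := by
    refine Measure.le_iff.2 fun S hS => ?_
    rw [Measure.map_apply hφ hS, withDensity_apply _ (hφ hS)]
    simpa using hpush S hS
  calc ∫⁻ x, w x * p (φ x) ∂ν = ∫⁻ x, p (φ x) ∂(ν.withDensity w) :=
        (lintegral_withDensity_eq_lintegral_mul _ hw (hp.comp hφ)).symm
    _ = ∫⁻ τ, p τ ∂((ν.withDensity w).map φ) := (lintegral_map hp hφ).symm
    _ ≤ ∫⁻ τ, p τ ∂(M • (volume : Measure ℝ)) := lintegral_mono' hle le_rfl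
    _ = M * ∫⁻ τ, p τ := by rw [lintegral_smul_measure, smul_eq_mul]

/-- The oscillatory integral `∫ e^{-i t φ(x)} H(x) dν(x)` as a function of the time `t`.
Free waves and their products have this form on the Fourier side. -/
def oscillatoryIntegral (ν : Measure X) (φ : X → ℝ) (H : X → ℂ) (t : ℝ) : ℂ :=
  ∫ x, Complex.exp (-Complex.I * ((t * φ x : ℝ) : ℂ)) * H x ∂ν

theorem norm_exp_neg_I_mul_ofReal (r : ℝ) : ‖Complex.exp (-Complex.I * (r : ℂ))‖ = 1 := by
  rw [Complex.norm_exp]; simp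

theorem continuous_oscillatoryIntegral {φ : X → ℝ} (hφ : Measurable φ) {H : X → ℂ}
    (hH : Integrable H ν) : Continuous (oscillatoryIntegral ν φ H) := by
  refine continuous_of_dominated (bound := fun x => ‖H x‖) (fun t => ?_) (fun t => ?_) hH.norm ?_
  · exact (Measurable.aestronglyMeasurable (by fun_prop)).mul hH.1
  · refine Filter.Eventually.of_forall fun x => ?_
    rw [norm_mul, norm_exp_neg_I_mul_ofReal, one_mul]
  · exact Filter.Eventually.of_forall fun x => by fun_prop

theorem lintegral_enorm_oscillatoryIntegral_id_sq {a : ℝ → ℂ} (h1 : Integrable a)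
    (h2 : MemLp a 2 volume) :
    ∫⁻ τ, ‖oscillatoryIntegral volume id a τ‖ₑ ^ 2
      = ENNReal.ofReal (2 * Real.pi) * ∫⁻ t, ‖a t‖ₑ ^ 2 := by
  have h := lintegral_enorm_integral_exp_neg_inner_sq h1 h2
  rw [Module.finrank_self, pow_one] at h
  simpa [oscillatoryIntegral, mul_comm] using h

theorem integral_mul_oscillatoryIntegral [SFinite ν] {φ : X → ℝ} (hφ : Measurable φ) {H : X → ℂ}
    (hH : Integrable H ν) {a : ℝ → ℂ} (ha : Integrable a) :
    ∫ t, a t * oscillatoryIntegral ν φ H t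
      = ∫ x, H x * oscillatoryIntegral volume id a (φ x) ∂ν := by
  have hint : Integrable (fun z : ℝ × X =>
      a z.1 * (Complex.exp (-Complex.I * ((z.1 * φ z.2 : ℝ) : ℂ)) * H z.2)) (volume.prod ν) := by
    refine ((ha.mul_prod hH).bdd_mul (c := 1)
      (f := fun z : ℝ × X => Complex.exp (-Complex.I * ((z.1 * φ z.2 : ℝ) : ℂ)))
      (Measurable.aestronglyMeasurable (by fun_prop)) ?_).congr ?_
    · exact Filter.Eventually.of_forall fun z => (norm_exp_neg_I_mul_ofReal _).le
    · exact Filter.Eventually.of_forall fun z => by ring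
  simp only [oscillatoryIntegral, ← integral_const_mul]
  rw [integral_integral_swap hint]
  refine integral_congr_ae (Filter.Eventually.of_forall fun x => ?_)
  refine integral_congr_ae (Filter.Eventually.of_forall fun t => ?_)
  simp only [id_eq, mul_comm t]
  ring

theorem enorm_integral_mul_oscillatoryIntegral_sq_le [SFinite ν] {φ : X → ℝ} (hφ : Measurable φ)
    {w : X → ENNReal} (hw : Measurable w) {M : ENNReal}
    (hpush : ∀ S : Set ℝ, MeasurableSet S → ∫⁻ x in φ ⁻¹' S, w x ∂ν ≤ M * volume S)
    {H : X → ℂ} (hH : Integrable H ν) {k : X → ENNReal} (hk : AEMeasurable k ν)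
    (hHk : ∀ x, ‖H x‖ₑ ^ 2 ≤ w x * k x) {a : ℝ → ℂ} (h1 : Integrable a)
    (h2 : MemLp a 2 volume) :
    ‖∫ t, a t * oscillatoryIntegral ν φ H t‖ₑ ^ 2
      ≤ ENNReal.ofReal (2 * Real.pi) * M * (∫⁻ x, k x ∂ν) * ∫⁻ t, ‖a t‖ₑ ^ 2 := by
  set b := oscillatoryIntegral volume id a
  have hb : Measurable fun τ => ‖b τ‖ₑ ^ 2 :=
    (continuous_oscillatoryIntegral measurable_id h1).measurable.enorm.pow_const 2
  calc ‖∫ t, a t * oscillatoryIntegral ν φ H t‖ₑ ^ 2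
      ≤ (∫⁻ x, ‖H x * b (φ x)‖ₑ ∂ν) ^ 2 := by
        rw [integral_mul_oscillatoryIntegral hφ hH h1]
        gcongr
        exact enorm_integral_le_lintegral_enorm _
    _ ≤ (∫⁻ x, w x * ‖b (φ x)‖ₑ ^ 2 ∂ν) * ∫⁻ x, k x ∂ν := by
        refine lintegral_sq_le_of_sq_le_mul (hw.mul (hb.comp hφ)).aemeasurable hk fun x => ?_
        rw [enorm_mul, mul_pow, mul_right_comm]
        gcongr
        exact hHk x
    _ ≤ (M * (ENNReal.ofReal (2 * Real.pi) * ∫⁻ t, ‖a t‖ₑ ^ 2)) * ∫⁻ x, k x ∂ν := by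
        rw [← lintegral_enorm_oscillatoryIntegral_id_sq h1 h2]
        gcongr
        exact lintegral_mul_comp_le_of_setLIntegral_preimage_le hφ hw hpush hb
    _ = _ := by ring

theorem lintegral_enorm_oscillatoryIntegral_sq_le [SFinite ν] {φ : X → ℝ} (hφ : Measurable φ)
    {w : X → ENNReal} (hw : Measurable w) {M : ENNReal}
    (hpush : ∀ S : Set ℝ, MeasurableSet S → ∫⁻ x in φ ⁻¹' S, w x ∂ν ≤ M * volume S)
    {H : X → ℂ} (hH : Integrable H ν) {k : X → ENNReal} (hk : AEMeasurable k ν)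
    (hHk : ∀ x, ‖H x‖ₑ ^ 2 ≤ w x * k x) :
    ∫⁻ t, ‖oscillatoryIntegral ν φ H t‖ₑ ^ 2
      ≤ ENNReal.ofReal (2 * Real.pi) * M * ∫⁻ x, k x ∂ν :=
  lintegral_enorm_sq_le_of_forall_enorm_integral_mul_sq_le
    (continuous_oscillatoryIntegral hφ hH).measurable fun _ h1 h2 =>
      enorm_integral_mul_oscillatoryIntegral_sq_le hφ hw hpush hH hk hHk h1 h2

end Oscillatory

section PhaseOnLine

theorem strictMono_div_sqrt_one_add_sq : StrictMono fun x : ℝ => x / √(1 + x ^ 2) := by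
  intro x y hxy
  have hmem : ∀ x : ℝ, Real.arctan x ∈ Set.Icc (-(Real.pi / 2)) (Real.pi / 2) := fun x =>
    ⟨(Real.neg_pi_div_two_lt_arctan x).le, (Real.arctan_lt_pi_div_two x).le⟩
  simp only [← Real.sin_arctan]
  exact Real.strictMonoOn_sin (hmem x) (hmem y) (Real.arctan_strictMono hxy)

theorem div_sqrt_add_sq_eq {A : ℝ} (hA : 0 < A) (t : ℝ) :
    t / √(A + t ^ 2) = (t / √A) / √(1 + (t / √A) ^ 2) := by
  have : √(A + t ^ 2) = √A * √(1 + (t / √A) ^ 2) := by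
    rw [← Real.sqrt_mul hA.le]
    congr 1
    rw [div_pow, Real.sq_sqrt hA.le]
    field_simp
  rw [this, div_div]

theorem hasDerivAt_sqrt_add_sq {A : ℝ} (hA : 0 < A) (c t : ℝ) :
    HasDerivAt (fun t => √(A + (t - c) ^ 2)) ((t - c) / √(A + (t - c) ^ 2)) t := by
  have h : HasDerivAt (fun t : ℝ => A + (t - c) ^ 2) (2 * (t - c)) t := by
    simpa using (((hasDerivAt_id t).sub_const c).pow 2).const_add A
  convert h.sqrt (by positivity) using 1
  field_simp

theorem setLIntegral_abs_deriv_le_of_injOn {f f' : ℝ → ℝ} (hf : ∀ t, HasDerivAt f (f' t) t)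
    {P : Set ℝ} (hP : MeasurableSet P) (hinj : Set.InjOn f P) {S : Set ℝ} (hS : MeasurableSet S) :
    ∫⁻ t in P ∩ f ⁻¹' S, ENNReal.ofReal |f' t| ≤ volume S := by
  have hfm : Measurable f :=
    (continuous_iff_continuousAt.2 fun t => (hf t).continuousAt).measurable
  have himage := lintegral_image_eq_lintegral_abs_deriv_mul (hP.inter (hfm hS))
    (fun t _ => (hf t).hasDerivWithinAt) (hinj.mono Set.inter_subset_left) fun _ => 1
  simp only [mul_one, setLIntegral_const, one_mul] at himage
  rw [← himage]
  exact measure_mono (by rintro _ ⟨t, ht, rfl⟩; exact ht.2)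

theorem setLIntegral_preimage_abs_deriv_le {f f' : ℝ → ℝ} (hf : ∀ t, HasDerivAt f (f' t) t)
    {P N : Set ℝ} (hP : Convex ℝ P) (hN : Convex ℝ N) (hpos : ∀ t ∈ P, 0 < f' t)
    (hneg : ∀ t ∈ N, f' t < 0) (hzero : ∀ t ∉ P ∪ N, f' t = 0) {S : Set ℝ}
    (hS : MeasurableSet S) :
    ∫⁻ t in f ⁻¹' S, ENNReal.ofReal |f' t| ≤ 2 * volume S := by
  have hfc : Continuous f := continuous_iff_continuousAt.2 fun t => (hf t).continuousAt
  have hPm : MeasurableSet P := hP.ordConnected.measurableSet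
  have hNm : MeasurableSet N := hN.ordConnected.measurableSet
  have hPinj : Set.InjOn f P := (strictMonoOn_of_deriv_pos hP hfc.continuousOn fun t ht => by
    rw [(hf t).deriv]; exact hpos t (interior_subset ht)).injOn
  have hNinj : Set.InjOn f N := (strictAntiOn_of_deriv_neg hN hfc.continuousOn fun t ht => by
    rw [(hf t).deriv]; exact hneg t (interior_subset ht)).injOn
  have hZ : ∫⁻ t in (P ∪ N)ᶜ ∩ f ⁻¹' S, ENNReal.ofReal |f' t| = 0 := by
    refine (setLIntegral_congr_fun (g := fun _ => 0)
      ((hPm.union hNm).compl.inter (hfc.measurable hS)) fun t ht => ?_).trans lintegral_zero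
    simp [hzero t ht.1]
  have hcover : f ⁻¹' S ⊆ ((P ∩ f ⁻¹' S) ∪ (N ∩ f ⁻¹' S)) ∪ ((P ∪ N)ᶜ ∩ f ⁻¹' S) := by
    rw [← Set.union_inter_distrib_right, ← Set.union_inter_distrib_right, Set.union_compl_self,
      Set.univ_inter]
  calc ∫⁻ t in f ⁻¹' S, ENNReal.ofReal |f' t|
      ≤ (∫⁻ t in P ∩ f ⁻¹' S, ENNReal.ofReal |f' t|)
        + (∫⁻ t in N ∩ f ⁻¹' S, ENNReal.ofReal |f' t|)
        + ∫⁻ t in (P ∪ N)ᶜ ∩ f ⁻¹' S, ENNReal.ofReal |f' t| :=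
        (lintegral_mono_set hcover).trans ((lintegral_union_le _ _ _).trans
          (add_le_add (lintegral_union_le _ _ _) le_rfl))
    _ ≤ volume S + volume S + 0 := by
        gcongr
        · exact setLIntegral_abs_deriv_le_of_injOn hf hPm hPinj hS
        · exact setLIntegral_abs_deriv_le_of_injOn hf hNm hNinj hS
        · exact hZ.le
    _ = 2 * volume S := by rw [add_zero, two_mul]

theorem setLIntegral_abs_deriv_sqrt_sub_sqrt_le {A B : ℝ} (hA : 0 < A) (hB : 0 < B) (c : ℝ)
    {ε : ℝ} (hε : ε = 1 ∨ ε = -1) {S : Set ℝ} (hS : MeasurableSet S) :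
    ∫⁻ t in (fun t => √(A + t ^ 2) - ε * √(B + (t - c) ^ 2)) ⁻¹' S,
      ENNReal.ofReal |t / √(A + t ^ 2) - ε * ((t - c) / √(B + (t - c) ^ 2))| ≤ 2 * volume S := by
  set g : ℝ → ℝ := fun x => x / √(1 + x ^ 2) with hg
  have hmono : StrictMono g := strictMono_div_sqrt_one_add_sq
  set u : ℝ → ℝ := fun t => t / √A with hu
  set v : ℝ → ℝ := fun t => ε * ((t - c) / √B) with hv
  -- Since `g` is increasing, the derivative has the sign of the affine function `u - v`.
  have hderiv : ∀ t, t / √(A + t ^ 2) - ε * ((t - c) / √(B + (t - c) ^ 2)) = g (u t) - g (v t) := by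
    intro t
    rw [div_sqrt_add_sq_eq hA, div_sqrt_add_sq_eq hB]
    rcases hε with rfl | rfl <;> simp [hg, hu, hv, neg_div]
  have hlin : IsLinearMap ℝ fun t => ((√A)⁻¹ - ε * (√B)⁻¹) * t :=
    ⟨fun x y => by ring, fun r x => by simp only [smul_eq_mul]; ring⟩
  have haffine : ∀ t, u t - v t = ((√A)⁻¹ - ε * (√B)⁻¹) * t - -(ε * (c * (√B)⁻¹)) := fun t => by
    simp only [hu, hv]; ring
  have hpos : ∀ t, -(ε * (c * (√B)⁻¹)) < ((√A)⁻¹ - ε * (√B)⁻¹) * t ↔ v t < u t := fun t => by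
    rw [← sub_pos, ← haffine, sub_pos]
  have hneg : ∀ t, ((√A)⁻¹ - ε * (√B)⁻¹) * t < -(ε * (c * (√B)⁻¹)) ↔ u t < v t := fun t => by
    rw [← sub_neg, ← haffine, sub_neg]
  refine setLIntegral_preimage_abs_deriv_le
    (P := {t | -(ε * (c * (√B)⁻¹)) < ((√A)⁻¹ - ε * (√B)⁻¹) * t})
    (N := {t | ((√A)⁻¹ - ε * (√B)⁻¹) * t < -(ε * (c * (√B)⁻¹))}) (fun t => ?_)
    (convex_halfSpace_gt hlin _) (convex_halfSpace_lt hlin _) (fun t ht => ?_) (fun t ht => ?_)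
    (fun t ht => ?_) hS
  · have hA' := hasDerivAt_sqrt_add_sq hA 0 t
    simp only [sub_zero] at hA'
    exact hA'.sub ((hasDerivAt_sqrt_add_sq hB c t).const_mul ε)
  · rw [hderiv, sub_pos]
    exact hmono ((hpos t).1 ht)
  · rw [hderiv, sub_neg]
    exact hmono ((hneg t).1 ht)
  · have huv : u t = v t := by
      simp only [Set.mem_union, Set.mem_ofPred_eq, hpos, hneg, not_or, not_lt] at ht
      exact ht.1.antisymm ht.2
    rw [hderiv, huv, sub_self]

end PhaseOnLine

section Cube

variable {ι : Type*}

/-- The closed cube in Euclidean space with lowest corner `c` and side length `R`. -/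
def cube (c : EuclideanSpace ℝ ι) (R : ℝ) : Set (EuclideanSpace ℝ ι) :=
  {η | ∀ k, c k ≤ η k ∧ η k ≤ c k + R}

theorem measurableSet_cube [Countable ι] (c : EuclideanSpace ℝ ι) (R : ℝ) :
    MeasurableSet (cube c R) := by
  have : cube c R = ⋂ k, {η : EuclideanSpace ℝ ι | η k ∈ Set.Icc (c k) (c k + R)} := by
    ext; simp [cube]
  rw [this]
  exact MeasurableSet.iInter fun k => measurableSet_Icc.preimage (by fun_prop)

theorem lintegral_eq_lintegral_insertNth {n : ℕ} (k : Fin (n + 1))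
    {F : EuclideanSpace ℝ (Fin (n + 1)) → ENNReal} (hF : Measurable F) :
    ∫⁻ η, F η = ∫⁻ y : Fin n → ℝ, ∫⁻ t : ℝ, F (WithLp.toLp 2 (k.insertNth t y)) := by
  have htoLp := (EuclideanSpace.volume_preserving_symm_measurableEquiv_toLp (Fin (n + 1))).symm
  have hinsert := (volume_preserving_piFinSuccAbove (fun _ : Fin (n + 1) => ℝ) k).symm
  have hF' : Measurable fun x : Fin (n + 1) → ℝ => F (WithLp.toLp 2 x) :=
    hF.comp (MeasurableEquiv.toLp 2 (Fin (n + 1) → ℝ)).measurable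
  rw [← htoLp.lintegral_comp hF]
  refine (hinsert.lintegral_comp hF').symm.trans ?_
  rw [Measure.volume_eq_prod, lintegral_prod_symm]
  · rfl
  · exact (hF'.comp (MeasurableEquiv.measurable _)).aemeasurable

theorem setLIntegral_cube_le_of_slices {n : ℕ} (k : Fin (n + 1))
    (c : EuclideanSpace ℝ (Fin (n + 1))) {R : ℝ} (hR : 0 ≤ R)
    {F : EuclideanSpace ℝ (Fin (n + 1)) → ENNReal} (hF : Measurable F) {N : ENNReal}
    (hN : ∀ᵐ y : Fin n → ℝ, ∫⁻ t : ℝ, F (WithLp.toLp 2 (k.insertNth t y)) ≤ N) :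
    ∫⁻ η in cube c R, F η ≤ N * ENNReal.ofReal (R ^ n) := by
  set Y : Set (Fin n → ℝ) :=
    Set.Icc (fun j => c (k.succAbove j)) (fun j => c (k.succAbove j) + R) with hY
  have hYvol : volume Y = ENNReal.ofReal (R ^ n) := by
    rw [hY, Real.volume_Icc_pi, ENNReal.ofReal_pow hR]
    simp
  rw [← lintegral_indicator (measurableSet_cube c R),
    lintegral_eq_lintegral_insertNth k (hF.indicator (measurableSet_cube c R))]
  calc ∫⁻ y : Fin n → ℝ, ∫⁻ t : ℝ, (cube c R).indicator F (WithLp.toLp 2 (k.insertNth t y))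
      ≤ ∫⁻ y, Y.indicator (fun _ => N) y := by
        refine lintegral_mono_ae (hN.mono fun y hy => ?_)
        by_cases hyY : y ∈ Y
        · rw [Set.indicator_of_mem hyY]
          exact (lintegral_mono fun t => Set.indicator_le_self _ _ _).trans hy
        · refine (lintegral_eq_zero_of_ae_eq_zero (Filter.Eventually.of_forall fun t =>
            Set.indicator_of_notMem (fun h => hyY ?_) _)).le.trans zero_le
          exact ⟨fun j => by simpa using (h (k.succAbove j)).1,
            fun j => by simpa using (h (k.succAbove j)).2⟩
    _ = N * ENNReal.ofReal (R ^ n) := by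
        rw [lintegral_indicator measurableSet_Icc, setLIntegral_const, hYvol]

end Cube

section Phase

/-- The phase `⟨η⟩_m - ε ⟨η - ξ⟩_m` of the interaction of the frequencies `η` and `η - ξ`. -/
def phase (m ε : ℝ) (ξ η : E3) : ℝ := bracket m η - ε * bracket m (η - ξ)

/-- The partial derivative in `η_k` of the phase. -/
def phaseDeriv (m ε : ℝ) (k : Fin 3) (ξ η : E3) : ℝ :=
  unitFreq m η k - ε * unitFreq m (η - ξ) k

theorem continuous_bracket (m : ℝ) : Continuous (bracket m) := by
  unfold bracket; fun_prop

theorem measurable_unitFreq (m : ℝ) : Measurable (unitFreq m) :=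
  ((continuous_bracket m).measurable.inv).smul measurable_id

theorem measurable_unitFreq_apply (m : ℝ) (k : Fin 3) : Measurable fun η => unitFreq m η k :=
  (show Measurable fun x : E3 => x k by fun_prop).comp (measurable_unitFreq m)

theorem measurable_phase (m ε : ℝ) : Measurable (Function.uncurry (phase m ε)) := by
  unfold phase bracket Function.uncurry; fun_prop

theorem measurable_phaseDeriv (m ε : ℝ) (k : Fin 3) :
    Measurable (Function.uncurry (phaseDeriv m ε k)) :=
  ((measurable_unitFreq_apply m k).comp measurable_snd).sub
    (((measurable_unitFreq_apply m k).comp (measurable_snd.sub measurable_fst)).const_mul ε)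

theorem toLp_insertNth_sub (k : Fin 3) (t : ℝ) (y : Fin 2 → ℝ) (ξ : E3) :
    (WithLp.toLp 2 (k.insertNth t y : Fin 3 → ℝ) : E3) - ξ
      = WithLp.toLp 2 (k.insertNth (t - ξ k) fun j => y j - ξ (k.succAbove j)) := by
  ext i
  refine Fin.succAboveCases k ?_ (fun j => ?_) i <;> simp

theorem bracket_insertNth (m : ℝ) (k : Fin 3) (t : ℝ) (y : Fin 2 → ℝ) :
    bracket m (WithLp.toLp 2 (k.insertNth t y : Fin 3 → ℝ))
      = √((m ^ 2 + ∑ j, y j ^ 2) + t ^ 2) := by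
  rw [bracket, EuclideanSpace.real_norm_sq_eq, Fin.sum_univ_succAbove _ k, add_assoc,
    add_comm (∑ j, y j ^ 2)]
  simp

theorem phase_insertNth (m ε : ℝ) (k : Fin 3) (ξ : E3) (t : ℝ) (y : Fin 2 → ℝ) :
    phase m ε ξ (WithLp.toLp 2 (k.insertNth t y : Fin 3 → ℝ))
      = √((m ^ 2 + ∑ j, y j ^ 2) + t ^ 2)
        - ε * √((m ^ 2 + ∑ j, (y j - ξ (k.succAbove j)) ^ 2) + (t - ξ k) ^ 2) := by
  rw [phase, toLp_insertNth_sub, bracket_insertNth, bracket_insertNth]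

theorem phaseDeriv_insertNth (m ε : ℝ) (k : Fin 3) (ξ : E3) (t : ℝ) (y : Fin 2 → ℝ) :
    phaseDeriv m ε k ξ (WithLp.toLp 2 (k.insertNth t y : Fin 3 → ℝ))
      = t / √((m ^ 2 + ∑ j, y j ^ 2) + t ^ 2) - ε * ((t - ξ k) /
        √((m ^ 2 + ∑ j, (y j - ξ (k.succAbove j)) ^ 2) + (t - ξ k) ^ 2)) := by
  rw [phaseDeriv, toLp_insertNth_sub, unitFreq, unitFreq, bracket_insertNth, bracket_insertNth]
  simp [div_eq_inv_mul]

theorem sum_sq_pos {ι : Type*} [Fintype ι] {y : ι → ℝ} (hy : y ≠ 0) : 0 < ∑ j, y j ^ 2 := by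
  obtain ⟨j, hj⟩ := Function.ne_iff.1 hy
  exact Finset.sum_pos' (fun _ _ => sq_nonneg _) ⟨j, Finset.mem_univ _, sq_pos_of_ne_zero hj⟩

theorem lintegral_slice_abs_phaseDeriv_le (m : ℝ) {ε : ℝ} (hε : ε = 1 ∨ ε = -1) (k : Fin 3)
    (ξ : E3) {S : Set ℝ} (hS : MeasurableSet S) {y : Fin 2 → ℝ} (hy : y ≠ 0)
    (hyξ : y ≠ fun j => ξ (k.succAbove j)) :
    ∫⁻ t : ℝ, (phase m ε ξ ⁻¹' S).indicator (fun η => ENNReal.ofReal |phaseDeriv m ε k ξ η|)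
      (WithLp.toLp 2 (k.insertNth t y : Fin 3 → ℝ)) ≤ 2 * volume S := by
  have hA : 0 < m ^ 2 + ∑ j, y j ^ 2 := add_pos_of_nonneg_of_pos (sq_nonneg m) (sum_sq_pos hy)
  have hB : 0 < m ^ 2 + ∑ j, (y j - ξ (k.succAbove j)) ^ 2 :=
    add_pos_of_nonneg_of_pos (sq_nonneg m) (sum_sq_pos (sub_ne_zero.2 hyξ))
  refine le_trans (le_of_eq ?_) (setLIntegral_abs_deriv_sqrt_sub_sqrt_le hA hB (ξ k) hε hS)
  rw [← lintegral_indicator (Continuous.measurable (by fun_prop) hS)]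
  refine lintegral_congr fun t => Set.indicator_eq_indicator ?_ ?_
  · simp only [Set.mem_preimage, phase_insertNth]
  · rw [phaseDeriv_insertNth]

theorem setLIntegral_abs_phaseDeriv_le (m : ℝ) {ε : ℝ} (hε : ε = 1 ∨ ε = -1) (k : Fin 3)
    (ξ c : E3) {R : ℝ} (hR : 0 ≤ R) {S : Set ℝ} (hS : MeasurableSet S) :
    ∫⁻ η in cube c R ∩ phase m ε ξ ⁻¹' S, ENNReal.ofReal |phaseDeriv m ε k ξ η|
      ≤ 2 * volume S * ENNReal.ofReal (R ^ 2) := by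
  have hpre : MeasurableSet (phase m ε ξ ⁻¹' S) := (measurable_phase m ε).of_uncurry_left hS
  have hderiv : Measurable fun η => ENNReal.ofReal |phaseDeriv m ε k ξ η| :=
    (continuous_abs.measurable.comp (measurable_phaseDeriv m ε k).of_uncurry_left).ennreal_ofReal
  rw [Set.inter_comm, ← setLIntegral_indicator hpre]
  refine setLIntegral_cube_le_of_slices k c hR (hderiv.indicator hpre) ?_
  filter_upwards [Measure.ae_ne volume (0 : Fin 2 → ℝ),
    Measure.ae_ne volume fun j => ξ (k.succAbove j)] with y hy hyξ
  exact lintegral_slice_abs_phaseDeriv_le m hε k ξ hS hy hyξ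

end Phase

section PhaseGradient

/-- The `ℓ¹` norm of the gradient in `η` of the phase. -/
def phaseGrad (m ε : ℝ) (ξ η : E3) : ℝ := ∑ k, |phaseDeriv m ε k ξ η|

theorem phaseGrad_nonneg (m ε : ℝ) (ξ η : E3) : 0 ≤ phaseGrad m ε ξ η :=
  Finset.sum_nonneg fun _ _ => abs_nonneg _

theorem measurable_phaseGrad (m ε : ℝ) : Measurable (Function.uncurry (phaseGrad m ε)) := by
  unfold phaseGrad Function.uncurry
  exact Finset.measurable_sum _ fun k _ =>
    continuous_abs.measurable.comp (measurable_phaseDeriv m ε k)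

theorem setLIntegral_phaseGrad_le (m : ℝ) {ε : ℝ} (hε : ε = 1 ∨ ε = -1) (ξ c : E3) {R : ℝ}
    (hR : 0 ≤ R) {S : Set ℝ} (hS : MeasurableSet S) :
    ∫⁻ η in cube c R ∩ phase m ε ξ ⁻¹' S, ENNReal.ofReal (phaseGrad m ε ξ η)
      ≤ 6 * ENNReal.ofReal (R ^ 2) * volume S := by
  have hderiv : ∀ k, Measurable fun η => ENNReal.ofReal |phaseDeriv m ε k ξ η| := fun k =>
    (continuous_abs.measurable.comp (measurable_phaseDeriv m ε k).of_uncurry_left).ennreal_ofReal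
  calc ∫⁻ η in cube c R ∩ phase m ε ξ ⁻¹' S, ENNReal.ofReal (phaseGrad m ε ξ η)
      = ∑ k, ∫⁻ η in cube c R ∩ phase m ε ξ ⁻¹' S, ENNReal.ofReal |phaseDeriv m ε k ξ η| := by
        simp only [phaseGrad, ENNReal.ofReal_sum_of_nonneg fun _ _ => abs_nonneg _]
        exact lintegral_finsetSum _ fun k _ => hderiv k
    _ ≤ ∑ _k : Fin 3, 2 * volume S * ENNReal.ofReal (R ^ 2) :=
        Finset.sum_le_sum fun k _ => setLIntegral_abs_phaseDeriv_le m hε k ξ c hR hS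
    _ = 6 * ENNReal.ofReal (R ^ 2) * volume S := by
        rw [Finset.sum_const, Finset.card_univ, Fintype.card_fin, nsmul_eq_mul]
        push_cast
        ring

end PhaseGradient

section Angular

/-- The angular null quantity `|a||b| - ε a·b` with `a = η/⟨η⟩_m` and `b = ζ/⟨ζ⟩_m`. It dominates
the squares of all three null symbols. -/
def angular (m ε : ℝ) (η ζ : E3) : ℝ :=
  ‖unitFreq m η‖ * ‖unitFreq m ζ‖ - ε * inner ℝ (unitFreq m η) (unitFreq m ζ)

theorem norm_le_bracket (m : ℝ) (η : E3) : ‖η‖ ≤ bracket m η :=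
  Real.le_sqrt_of_sq_le (by nlinarith [sq_nonneg m])

theorem bracket_nonneg (m : ℝ) (η : E3) : 0 ≤ bracket m η := Real.sqrt_nonneg _

theorem bracket_smul_unitFreq (m : ℝ) (η : E3) : bracket m η • unitFreq m η = η := by
  rcases eq_or_ne (bracket m η) 0 with h | h
  · rw [h, zero_smul, eq_comm, ← norm_le_zero_iff]
    exact (norm_le_bracket m η).trans h.le
  · rw [unitFreq, smul_inv_smul₀ h]

theorem bracket_mul_norm_unitFreq (m : ℝ) (η : E3) : bracket m η * ‖unitFreq m η‖ = ‖η‖ := by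
  conv_rhs => rw [← bracket_smul_unitFreq m η, norm_smul, Real.norm_of_nonneg (bracket_nonneg m η)]

theorem norm_unitFreq_le_one (m : ℝ) (η : E3) : ‖unitFreq m η‖ ≤ 1 := by
  rw [unitFreq, norm_smul, norm_inv, Real.norm_of_nonneg (bracket_nonneg m η), ← div_eq_inv_mul]
  exact div_le_one_of_le₀ (norm_le_bracket m η) (bracket_nonneg m η)

theorem norm_unitFreq_mul_le_one (m : ℝ) (η ζ : E3) : ‖unitFreq m η‖ * ‖unitFreq m ζ‖ ≤ 1 :=
  mul_le_one₀ (norm_unitFreq_le_one m η) (norm_nonneg _) (norm_unitFreq_le_one m ζ)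

theorem abs_sign_mul_inner_le {V : Type*} [NormedAddCommGroup V] [InnerProductSpace ℝ V] {ε : ℝ}
    (hε : ε = 1 ∨ ε = -1) (a b : V) : |ε * inner ℝ a b| ≤ ‖a‖ * ‖b‖ := by
  rcases hε with rfl | rfl <;> simpa using abs_real_inner_le_norm a b

theorem angular_nonneg {m ε : ℝ} (hε : ε = 1 ∨ ε = -1) (η ζ : E3) : 0 ≤ angular m ε η ζ :=
  sub_nonneg.2 (abs_le.1 (abs_sign_mul_inner_le hε _ _)).2

theorem angular_le_two {m ε : ℝ} (hε : ε = 1 ∨ ε = -1) (η ζ : E3) : angular m ε η ζ ≤ 2 := by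
  have := (abs_le.1 (abs_sign_mul_inner_le hε (unitFreq m η) (unitFreq m ζ))).1
  have := norm_unitFreq_mul_le_one m η ζ
  unfold angular; linarith

theorem two_mul_norm_mul_norm_sub_inner_le {V : Type*} [NormedAddCommGroup V]
    [InnerProductSpace ℝ V] {ε : ℝ} (hε : ε = 1 ∨ ε = -1) (a b : V) :
    2 * (‖a‖ * ‖b‖ - ε * inner ℝ a b) ≤ ‖a - ε • b‖ ^ 2 := by
  have hnorm : ‖ε • b‖ = ‖b‖ := by rcases hε with rfl | rfl <;> simp
  rw [norm_sub_sq_real, real_inner_smul_right, hnorm]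
  nlinarith [sq_nonneg (‖a‖ - ‖b‖)]

theorem two_mul_angular_le_phaseGrad_sq {m ε : ℝ} (hε : ε = 1 ∨ ε = -1) (ξ η : E3) :
    2 * angular m ε η (η - ξ) ≤ phaseGrad m ε ξ η ^ 2 :=
  calc 2 * angular m ε η (η - ξ) ≤ ‖unitFreq m η - ε • unitFreq m (η - ξ)‖ ^ 2 :=
        two_mul_norm_mul_norm_sub_inner_le hε _ _
    _ = ∑ k, |phaseDeriv m ε k ξ η| ^ 2 := by
        simp [EuclideanSpace.real_norm_sq_eq, phaseDeriv]
    _ ≤ phaseGrad m ε ξ η ^ 2 := Finset.sum_sq_le_sq_sum_of_nonneg fun _ _ => abs_nonneg _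

theorem angular_one_mul_bracket_le (m : ℝ) (ξ η : E3) :
    angular m 1 η (η - ξ) * (2 * bracket m η * bracket m (η - ξ)) ≤ ‖ξ‖ ^ 2 := by
  have hangular : angular m 1 η (η - ξ) * (2 * bracket m η * bracket m (η - ξ))
      = 2 * (‖η‖ * ‖η - ξ‖ - inner ℝ η (η - ξ)) := by
    have hinner := congrArg₂ (inner ℝ) (bracket_smul_unitFreq m η) (bracket_smul_unitFreq m (η - ξ))
    rw [real_inner_smul_left, real_inner_smul_right] at hinner
    rw [← hinner, ← bracket_mul_norm_unitFreq m η, ← bracket_mul_norm_unitFreq m (η - ξ), angular]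
    ring
  rw [hangular]
  simpa using two_mul_norm_mul_norm_sub_inner_le (Or.inl rfl) η (η - ξ)

end Angular

section NullSymbol

theorem sum_mul_norm_sub_sq {ι : Type*} [Fintype ι] {ε : ℝ} (hε : ε = 1 ∨ ε = -1)
    (a b : EuclideanSpace ℝ ι) :
    ∑ k, (a k * ‖b‖ - ε * (b k * ‖a‖)) ^ 2
      = 2 * (‖a‖ * ‖b‖) * (‖a‖ * ‖b‖ - ε * inner ℝ a b) := by
  have hε2 : ε ^ 2 = 1 := by rcases hε with rfl | rfl <;> norm_num
  have hsum : ∑ k, (a k * ‖b‖ - ε * (b k * ‖a‖)) ^ 2 = ‖‖b‖ • a - (ε * ‖a‖) • b‖ ^ 2 := by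
    rw [EuclideanSpace.real_norm_sq_eq]
    exact Finset.sum_congr rfl fun k _ => by simp; ring
  rw [hsum, norm_sub_sq_real, real_inner_smul_left, real_inner_smul_right, norm_smul, norm_smul,
    Real.norm_eq_abs, Real.norm_eq_abs, mul_pow, mul_pow, sq_abs, sq_abs]
  linear_combination ‖a‖ ^ 2 * ‖b‖ ^ 2 * hε2

theorem sum_crossProduct_sq {ε : ℝ} (hε : ε = 1 ∨ ε = -1) (a b : E3) :
    ∑ k, (crossProduct (fun k => a k) (fun k => b k) : Fin 3 → ℝ) k ^ 2
      = (‖a‖ * ‖b‖ - ε * inner ℝ a b) * (‖a‖ * ‖b‖ + ε * inner ℝ a b) := by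
  have hε2 : ε ^ 2 = 1 := by rcases hε with rfl | rfl <;> norm_num
  have hLagrange : ∑ k, (crossProduct (fun k => a k) (fun k => b k) : Fin 3 → ℝ) k ^ 2
      = ‖a‖ ^ 2 * ‖b‖ ^ 2 - inner ℝ a b ^ 2 := by
    simp only [EuclideanSpace.real_norm_sq_eq, PiLp.inner_apply, Fin.sum_univ_three, cross_apply,
      RCLike.inner_apply, conj_trivial, Matrix.cons_val]
    ring
  rw [hLagrange]
  linear_combination (inner ℝ a b) ^ 2 * hε2

theorem norm_vecDot_apply_sq_le (v : Fin 3 → ℝ) {M : Fin 3 → Mat4}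
    (hM : ∀ k i j, ‖M k i j‖ ≤ 1) (i j : Fin 2 ⊕ Fin 2) :
    ‖vecDot v M i j‖ ^ 2 ≤ 3 * ∑ k, v k ^ 2 := by
  have hsum : ‖vecDot v M i j‖ ≤ ∑ k, |v k| := by
    rw [vecDot, Matrix.sum_apply]
    refine (norm_sum_le _ _).trans (Finset.sum_le_sum fun k _ => ?_)
    rw [Matrix.smul_apply, smul_eq_mul, norm_mul, Complex.norm_real, Real.norm_eq_abs]
    exact mul_le_of_le_one_right (abs_nonneg _) (hM k i j)
  calc ‖vecDot v M i j‖ ^ 2 ≤ (∑ k, |v k|) ^ 2 := by gcongr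
    _ ≤ 3 * ∑ k, |v k| ^ 2 := by
      simpa using sq_sum_le_card_mul_sum_sq (s := Finset.univ) (f := fun k : Fin 3 => |v k|)
    _ = 3 * ∑ k, v k ^ 2 := by simp only [sq_abs]

theorem norm_alpha_apply_le_one (k : Fin 3) (i j : Fin 2 ⊕ Fin 2) : ‖alpha k i j‖ ≤ 1 := by
  rw [alpha, beta, gamma, Matrix.fromBlocks_multiply]
  fin_cases k <;> rcases i with i | i <;> rcases j with j | j <;> fin_cases i <;> fin_cases j <;>
    simp [pauli]

theorem norm_spin_apply_le_one (k : Fin 3) (i j : Fin 2 ⊕ Fin 2) : ‖spin k i j‖ ≤ 1 := by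
  rw [spin]
  fin_cases k <;> rcases i with i | i <;> rcases j with j | j <;> fin_cases i <;> fin_cases j <;>
    simp [pauli]

theorem norm_nullSymbol_zero_apply_sq_le {m ε : ℝ} (hε : ε = 1 ∨ ε = -1) (η ζ : E3)
    (i j : Fin 2 ⊕ Fin 2) : ‖nullSymbol m ε 0 η ζ i j‖ ^ 2 ≤ 6 * angular m ε η ζ := by
  have h0 := angular_nonneg (m := m) hε η ζ
  have hone : ‖(1 : Mat4) i j‖ ≤ 1 := by rw [Matrix.one_apply]; split_ifs <;> simp
  calc ‖nullSymbol m ε 0 η ζ i j‖ ^ 2 = (angular m ε η ζ * ‖(1 : Mat4) i j‖) ^ 2 := by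
        rw [show nullSymbol m ε 0 η ζ = ((angular m ε η ζ : ℝ) : ℂ) • (1 : Mat4) from rfl,
          Matrix.smul_apply, smul_eq_mul, norm_mul, Complex.norm_real, Real.norm_of_nonneg h0]
    _ ≤ angular m ε η ζ ^ 2 := by gcongr; exact mul_le_of_le_one_right h0 hone
    _ ≤ 6 * angular m ε η ζ := by nlinarith [angular_le_two (m := m) hε η ζ]

theorem norm_nullSymbol_one_apply_sq_le {m ε : ℝ} (hε : ε = 1 ∨ ε = -1) (η ζ : E3)
    (i j : Fin 2 ⊕ Fin 2) : ‖nullSymbol m ε 1 η ζ i j‖ ^ 2 ≤ 6 * angular m ε η ζ := by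
  set a := unitFreq m η with ha
  set b := unitFreq m ζ with hb
  calc ‖nullSymbol m ε 1 η ζ i j‖ ^ 2
      ≤ 3 * ∑ k, (a k * ‖b‖ - ε * (b k * ‖a‖)) ^ 2 := by
        rw [show nullSymbol m ε 1 η ζ = -vecDot (fun k => a k * ‖b‖ - ε * (b k * ‖a‖)) alpha
          from rfl, Matrix.neg_apply, norm_neg]
        exact norm_vecDot_apply_sq_le _ norm_alpha_apply_le_one i j
    _ = 6 * ((‖a‖ * ‖b‖) * angular m ε η ζ) := by
        rw [sum_mul_norm_sub_sq hε, angular, ← ha, ← hb]; ring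
    _ ≤ 6 * angular m ε η ζ := by
        gcongr
        exact mul_le_of_le_one_left (angular_nonneg hε η ζ) (norm_unitFreq_mul_le_one m η ζ)

theorem norm_nullSymbol_two_apply_sq_le {m ε : ℝ} (hε : ε = 1 ∨ ε = -1) (η ζ : E3)
    (i j : Fin 2 ⊕ Fin 2) : ‖nullSymbol m ε 2 η ζ i j‖ ^ 2 ≤ 6 * angular m ε η ζ := by
  set a := unitFreq m η
  set b := unitFreq m ζ
  have hεn : ‖(ε : ℂ)‖ = 1 := by rcases hε with rfl | rfl <;> simp
  have hsum : ‖a‖ * ‖b‖ + ε * inner ℝ a b ≤ 2 := by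
    have := (abs_le.1 (abs_sign_mul_inner_le hε a b)).2
    have := norm_unitFreq_mul_le_one m η ζ
    linarith
  calc ‖nullSymbol m ε 2 η ζ i j‖ ^ 2
      ≤ 3 * ∑ k, (crossProduct (fun k => a k) (fun k => b k) : Fin 3 → ℝ) k ^ 2 := by
        rw [show nullSymbol m ε 2 η ζ = (-(ε : ℂ) * Complex.I) •
            vecDot (crossProduct (fun k => a k) (fun k => b k)) spin from rfl,
          Matrix.smul_apply, smul_eq_mul, norm_mul, norm_mul, norm_neg, hεn, Complex.norm_I,
          one_mul, one_mul]
        exact norm_vecDot_apply_sq_le _ norm_spin_apply_le_one i j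
    _ = 3 * (angular m ε η ζ * (‖a‖ * ‖b‖ + ε * inner ℝ a b)) := by
        rw [sum_crossProduct_sq hε, angular]
    _ ≤ 3 * (angular m ε η ζ * 2) := by
        gcongr
        exact angular_nonneg hε η ζ
    _ = 6 * angular m ε η ζ := by ring

theorem norm_nullSymbol_apply_sq_le {m ε : ℝ} (hε : ε = 1 ∨ ε = -1) (l : Fin 3) (η ζ : E3)
    (i j : Fin 2 ⊕ Fin 2) : ‖nullSymbol m ε l η ζ i j‖ ^ 2 ≤ 6 * angular m ε η ζ := by
  fin_cases l
  · exact norm_nullSymbol_zero_apply_sq_le hε η ζ i j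
  · exact norm_nullSymbol_one_apply_sq_le hε η ζ i j
  · exact norm_nullSymbol_two_apply_sq_le hε η ζ i j

theorem norm_beta_mulVec_apply (v : Fin 2 ⊕ Fin 2 → ℂ) (i : Fin 2 ⊕ Fin 2) :
    ‖(beta *ᵥ v) i‖ = ‖v i‖ := by
  rcases i with i | i <;>
    simp [beta, Matrix.mulVec, dotProduct, Fintype.sum_sum_type, Matrix.one_apply]

theorem norm_mulVec_apply_le {M : Mat4} {c : ℝ} (hM : ∀ i j, ‖M i j‖ ≤ c) (w : Spinor)
    (i : Fin 2 ⊕ Fin 2) : ‖(M *ᵥ w.ofLp) i‖ ≤ 4 * (c * ‖w‖) := by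
  have hc : 0 ≤ c := (norm_nonneg _).trans (hM i i)
  rw [Matrix.mulVec, dotProduct]
  refine (norm_sum_le _ _).trans
    ((Finset.sum_le_card_nsmul _ _ (c * ‖w‖) fun j _ => ?_).trans (by simp))
  rw [norm_mul]
  exact mul_le_mul (hM i j) (PiLp.norm_apply_le w j) (norm_nonneg _) hc

theorem norm_spinorInner_beta_mulVec_le {M : Mat4} {c : ℝ} (hM : ∀ i j, ‖M i j‖ ≤ c)
    (v w : Spinor) :
    ‖spinorInner (beta *ᵥ v.ofLp) (M *ᵥ w.ofLp)‖ ≤ 16 * c * ‖v‖ * ‖w‖ := by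
  rw [spinorInner, dotProduct]
  refine (norm_sum_le _ _).trans
    ((Finset.sum_le_card_nsmul _ _ (‖v‖ * (4 * (c * ‖w‖))) fun j _ => ?_).trans_eq ?_)
  · rw [norm_mul, Pi.star_apply, norm_star, norm_beta_mulVec_apply]
    exact mul_le_mul (PiLp.norm_apply_le v j) (norm_mulVec_apply_le hM w j) (norm_nonneg _)
      (norm_nonneg _)
  · simp only [Finset.card_univ, Fintype.card_sum, Fintype.card_fin, nsmul_eq_mul]
    push_cast
    ring

theorem norm_spinorInner_nullSymbol_sq_le {m ε : ℝ} (hε : ε = 1 ∨ ε = -1) (l : Fin 3) (η ζ : E3)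
    (v w : Spinor) :
    ‖spinorInner (beta *ᵥ v.ofLp) (nullSymbol m ε l η ζ *ᵥ w.ofLp)‖ ^ 2
      ≤ 1536 * angular m ε η ζ * ‖v‖ ^ 2 * ‖w‖ ^ 2 := by
  have h0 := angular_nonneg (m := m) hε η ζ
  have h := norm_spinorInner_beta_mulVec_le (c := √(6 * angular m ε η ζ))
    (fun i j => Real.le_sqrt_of_sq_le (norm_nullSymbol_apply_sq_le hε l η ζ i j)) v w
  calc ‖spinorInner (beta *ᵥ v.ofLp) (nullSymbol m ε l η ζ *ᵥ w.ofLp)‖ ^ 2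
      ≤ (16 * √(6 * angular m ε η ζ) * ‖v‖ * ‖w‖) ^ 2 := by gcongr
    _ = 1536 * angular m ε η ζ * ‖v‖ ^ 2 * ‖w‖ ^ 2 := by
      rw [mul_pow, mul_pow, mul_pow, Real.sq_sqrt (by positivity)]
      ring

end NullSymbol

section Hat

theorem measurable_hat (f : L2) : Measurable (hat f) :=
  (Lp.stronglyMeasurable _).measurable.comp (measurable_const_smul _)

theorem quasiMeasurePreserving_smul {V : Type*} [NormedAddCommGroup V] [NormedSpace ℝ V]
    [FiniteDimensional ℝ V] [MeasurableSpace V] [BorelSpace V] (ν : Measure V)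
    [ν.IsAddHaarMeasure] {r : ℝ} (hr : r ≠ 0) :
    Measure.QuasiMeasurePreserving (fun x : V => r • x) ν ν := by
  refine ⟨measurable_const_smul r, ?_⟩
  rw [Measure.map_addHaar_smul _ hr]
  exact Measure.smul_absolutelyContinuous

theorem hat_fourierMultiplier_ae_eq (a : E3 → ℂ) (ha : Measurable a)
    (hb : ∃ C : ℝ, ∀ ξ, ‖a ξ‖ ≤ C) (f : L2) :
    hat (fourierMultiplier a ha hb f) =ᵐ[volume] fun ξ => a ξ • hat f ξ := by
  have hsmul := quasiMeasurePreserving_smul (volume : Measure E3)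
    (inv_ne_zero Real.two_pi_pos.ne')
  filter_upwards [hsmul.ae (memLp_multiplier a ha hb (𝓕 f : L2)).coeFn_toLp] with ξ hξ
  simp only [hat, fourierMultiplier]
  rw [FourierTransform.fourier_fourierInv_eq, hξ, smul_smul,
    mul_inv_cancel₀ Real.two_pi_pos.ne', one_smul]

theorem lintegral_enorm_hat_sq (f : L2) :
    ∫⁻ ξ, ‖hat f ξ‖ₑ ^ 2 = ENNReal.ofReal ((2 * Real.pi) ^ 3) * ‖f‖ₑ ^ 2 := by
  have h := lintegral_comp_inv_smul (V := E3) Real.two_pi_pos fun x => ‖(𝓕 f : L2) x‖ₑ ^ 2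
  rw [finrank_euclideanSpace_fin, ← eLpNorm_two_sq (𝓕 f : L2), ← Lp.enorm_def] at h
  rw [← ofReal_norm f, ← Lp.norm_fourier_eq f, ofReal_norm]
  exact h

theorem lintegral_enorm_sq_of_hat_ae_eq {f : L2} {F : E3 → Spinor} (hF : hat f =ᵐ[volume] F) :
    ∫⁻ ξ, ‖F ξ‖ₑ ^ 2 = ENNReal.ofReal ((2 * Real.pi) ^ 3 * ‖f‖ ^ 2) := by
  rw [ENNReal.ofReal_mul (by positivity), ENNReal.ofReal_pow (norm_nonneg _), ofReal_norm,
    ← lintegral_enorm_hat_sq]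
  exact lintegral_congr_ae (hF.symm.mono fun η h => by simp only [h])

end Hat

section Shell

theorem Cutoff.toFun_eq_zero (χ : Cutoff) {s : ℝ} (hs : 2 ≤ |s|) : χ.toFun s = 0 := by
  by_contra h
  have := χ.tsupport_subset (subset_tsupport _ h)
  exact absurd (abs_lt.2 ⟨this.1, this.2⟩) (not_lt.2 hs)

theorem le_two_mul_of_rho_ne_zero (χ : Cutoff) {l s : ℝ} (hl : 1 ≤ l) (hs : 0 ≤ s)
    (h : rho χ l s ≠ 0) : s ≤ 2 * l := by
  have hl0 : 0 < l := by linarith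
  contrapose! h
  have h1 : 2 ≤ |s / l| := (by rw [le_div_iff₀ hl0]; linarith : 2 ≤ s / l).trans (le_abs_self _)
  have h2 : 2 ≤ |2 * s / l| :=
    (by rw [le_div_iff₀ hl0]; linarith : 2 ≤ 2 * s / l).trans (le_abs_self _)
  have hs2 : 2 ≤ |s| := by rw [abs_of_nonneg hs]; linarith
  simp only [rho, χ.toFun_eq_zero hs2, χ.toFun_eq_zero h1, χ.toFun_eq_zero h2, sub_self, ite_self]

theorem le_two_mul_of_rho_ne_zero_of_one_lt (χ : Cutoff) {l s : ℝ} (hl : 1 < l) (hs : 0 ≤ s)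
    (h : rho χ l s ≠ 0) : l ≤ 2 * s := by
  have hl0 : 0 < l := by linarith
  contrapose! h
  have h1 : |s / l| ≤ 1 := by rw [abs_of_nonneg (by positivity), div_le_one hl0]; linarith
  have h2 : |2 * s / l| ≤ 1 := by rw [abs_of_nonneg (by positivity), div_le_one hl0]; linarith
  rw [rho, if_neg hl.not_gt, if_neg hl.ne', χ.eq_one _ h1, χ.eq_one _ h2, sub_self]

theorem exists_abs_rho_le (χ : Cutoff) : ∃ C : ℝ, 0 < C ∧ ∀ l s, |rho χ l s| ≤ C := by
  obtain ⟨C, hC⟩ := χ.bounded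
  have h0 : 0 ≤ C := (norm_nonneg _).trans (hC 0)
  refine ⟨C + C + 1, by linarith, fun l s => ?_⟩
  unfold rho
  split_ifs
  · simpa using by linarith
  · exact (hC _).trans (by linarith)
  · exact (norm_sub_le _ _).trans ((add_le_add (hC _) (hC _)).trans (by linarith))

/-- The frequencies carrying the projection `P_l`: the shell `l / 2 ≤ |η| ≤ 2 l` for `l > 1`, and
the ball `|η| ≤ 2` for `l = 1`. -/
def shell (l : ℝ) : Set E3 := {η | ‖η‖ ≤ 2 * l ∧ (1 < l → l ≤ 2 * ‖η‖)}

theorem measurableSet_shell (l : ℝ) : MeasurableSet (shell l) :=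
  (measurableSet_le measurable_norm measurable_const).inter
    ((MeasurableSet.const _).imp (measurableSet_le measurable_const (measurable_norm.const_mul 2)))

theorem hat_freqProj_ae_eq_indicator (χ : Cutoff) {l : ℝ} (hl : 1 ≤ l) (f : L2) :
    hat (freqProj χ l f) =ᵐ[volume] (shell l).indicator (hat (freqProj χ l f)) := by
  filter_upwards [hat_fourierMultiplier_ae_eq _ (measurable_rho_norm χ l)
    (bounded_rho_norm χ l) f] with η hη
  by_cases h : η ∈ shell l
  · rw [Set.indicator_of_mem h]
  · have hρ : rho χ l ‖η‖ = 0 := by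
      contrapose! h
      exact ⟨le_two_mul_of_rho_ne_zero χ hl (norm_nonneg η) h,
        fun hl' => le_two_mul_of_rho_ne_zero_of_one_lt χ hl' (norm_nonneg η) h⟩
    rw [Set.indicator_of_notMem h, freqProj, hη, hρ, Complex.ofReal_zero, zero_smul]

theorem angular_one_mul_le_of_mem_shell (m : ℝ) {μ l₁ l₂ : ℝ} (hμ : 1 ≤ μ) (h₁ : 1 ≤ l₁)
    (h₂ : 1 ≤ l₂) {ξ η : E3} (hξ : ‖ξ‖ ≤ 2 * μ) (hη : η ∈ shell l₁) (hζ : η - ξ ∈ shell l₂) :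
    angular m 1 η (η - ξ) * (l₁ * l₂) ≤ 16 * μ ^ 2 := by
  have h0 := angular_nonneg (m := m) (Or.inl rfl) η (η - ξ)
  have h2 := angular_le_two (m := m) (Or.inl rfl) η (η - ξ)
  rcases h₁.eq_or_lt with rfl | h₁' <;> rcases h₂.eq_or_lt with rfl | h₂'
  · nlinarith
  · have hl : l₂ ≤ 8 * μ := by
      linarith [hζ.2 h₂', hη.1, norm_sub_le η ξ]
    nlinarith
  · have hl : l₁ ≤ 8 * μ := by
      linarith [hη.2 h₁', hζ.1, norm_le_norm_sub_add η ξ]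
    nlinarith
  · have hl₁ : l₁ ≤ 2 * bracket m η := by linarith [hη.2 h₁', norm_le_bracket m η]
    have hl₂ : l₂ ≤ 2 * bracket m (η - ξ) := by linarith [hζ.2 h₂', norm_le_bracket m (η - ξ)]
    calc angular m 1 η (η - ξ) * (l₁ * l₂)
        ≤ angular m 1 η (η - ξ) * ((2 * bracket m η) * (2 * bracket m (η - ξ))) := by
          gcongr
          linarith
      _ = 2 * (angular m 1 η (η - ξ) * (2 * bracket m η * bracket m (η - ξ))) := by ring
      _ ≤ 2 * (2 * μ) ^ 2 := by
          gcongr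
          exact (angular_one_mul_bracket_le m ξ η).trans (by gcongr)
      _ ≤ 16 * μ ^ 2 := by nlinarith [sq_nonneg μ]

theorem angular_one_le_sq_of_mem_shell (m : ℝ) {K μ l₁ l₂ : ℝ} (hK : 1 ≤ K) (hμ : 1 ≤ μ)
    (h₁ : 1 ≤ l₁) (h₂ : 1 ≤ l₂) (hl : l₁ ≤ K * l₂) {ξ η : E3} (hξ : ‖ξ‖ ≤ 2 * μ)
    (hη : η ∈ shell l₁) (hζ : η - ξ ∈ shell l₂) :
    angular m 1 η (η - ξ) ≤ (4 * K * (μ / l₁)) ^ 2 := by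
  have h0 := angular_nonneg (m := m) (Or.inl rfl) η (η - ξ)
  have h := angular_one_mul_le_of_mem_shell m hμ h₁ h₂ hξ hη hζ
  rw [← mul_div_assoc, div_pow, le_div_iff₀ (by positivity)]
  calc angular m 1 η (η - ξ) * l₁ ^ 2
      ≤ angular m 1 η (η - ξ) * (l₁ * (K * l₂)) := by
        rw [sq]
        gcongr
    _ = K * (angular m 1 η (η - ξ) * (l₁ * l₂)) := by ring
    _ ≤ K ^ 2 * (16 * μ ^ 2) := by
        gcongr
        exact le_self_pow₀ hK two_ne_zero
    _ = (4 * K * μ) ^ 2 := by ring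

end Shell

section Amplitude

theorem spinorInner_smul_smul (M : Mat4) (c d : ℂ) (v w : Spinor) :
    spinorInner (beta *ᵥ (c • v).ofLp) (M *ᵥ (d • w).ofLp)
      = c * star d * spinorInner (beta *ᵥ v.ofLp) (M *ᵥ w.ofLp) := by
  simp only [spinorInner, WithLp.ofLp_smul, Matrix.mulVec_smul, star_smul, smul_dotProduct,
    dotProduct_smul, smul_eq_mul]
  ring

theorem propagatorSymbol_mul_star (m ε t : ℝ) (ξ η : E3) :
    propagatorSymbol m t η * star (propagatorSymbol m (ε * t) (η - ξ))
      = Complex.exp (-Complex.I * ((t * phase m ε ξ η : ℝ) : ℂ)) := by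
  simp only [propagatorSymbol, phase, RCLike.star_def]
  rw [← Complex.exp_conj, ← Complex.exp_add]
  congr 1
  simp only [map_mul, map_neg, Complex.conj_I, Complex.conj_ofReal]
  push_cast
  ring

/-- The amplitude of `P_μ Q_j(ψ, φ)` at output frequency `ξ`, as a function of the frequency `η`
of `ψ`; here `F` and `G` stand for the transforms of `ψ` and `φ`. -/
def amplitude (χ : Cutoff) (m ε μ : ℝ) (j : Fin 3) (F G : E3 → Spinor) (ξ η : E3) : ℂ :=
  ((rho χ μ ‖ξ‖ : ℝ) : ℂ) * spinorInner (beta *ᵥ (F η).ofLp)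
    (nullSymbol m ε j η (η - ξ) *ᵥ (G (η - ξ)).ofLp)

/-- The spatial Fourier transform at `p = (t, ξ)` of the bilinear interaction with amplitude `h` of
two free waves, the second one running backwards in time for `ε = -1`. -/
def interaction (m ε : ℝ) (h : E3 → E3 → ℂ) (p : ℝ × E3) : ℂ :=
  oscillatoryIntegral volume (phase m ε p.2) (h p.2) p.1

theorem waveNullForm_eq_invFourier_interaction (χ : Cutoff) (m ε μ : ℝ) (j : Fin 3) {f g : L2}
    {F G : E3 → Spinor} (hF : hat f =ᵐ[volume] F) (hG : hat g =ᵐ[volume] G) (p : ℝ × E3) :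
    waveNullForm χ m ε μ j f g p
      = invFourier (fun ξ => interaction m ε (amplitude χ m ε μ j F G) (p.1, ξ)) p.2 := by
  rw [waveNullForm, projNullForm]
  congr 1
  ext ξ
  rw [interaction, oscillatoryIntegral, nullFormHat, ← integral_const_mul]
  have hψ := hat_fourierMultiplier_ae_eq _ (measurable_propagatorSymbol m p.1)
    (bounded_propagatorSymbol m p.1) f
  have hφ := hat_fourierMultiplier_ae_eq _ (measurable_propagatorSymbol m (ε * p.1))
    (bounded_propagatorSymbol m (ε * p.1)) g
  have hsub := (measurePreserving_sub_right (volume : Measure E3) ξ).quasiMeasurePreserving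
  refine integral_congr_ae ?_
  filter_upwards [hψ, hF, hsub.ae hφ, hsub.ae hG] with η hψη hFη hφη hGη
  rw [propagator, propagator, hψη, hFη, hφη, hGη, spinorInner_smul_smul,
    propagatorSymbol_mul_star, amplitude]
  ring

theorem measurable_vecDot_apply {X : Type*} [MeasurableSpace X] {v : X → Fin 3 → ℝ}
    (hv : ∀ k, Measurable fun x => v x k) (M : Fin 3 → Mat4) (a b : Fin 2 ⊕ Fin 2) :
    Measurable fun x => vecDot (v x) M a b := by
  simp only [vecDot, Matrix.sum_apply, Matrix.smul_apply, smul_eq_mul]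
  exact Finset.measurable_sum _ fun k _ =>
    (Complex.measurable_ofReal.comp (hv k)).mul_const _

theorem measurable_nullSymbol_apply (m ε : ℝ) (j : Fin 3) {X : Type*} [MeasurableSpace X]
    {η ζ : X → E3} (hη : Measurable η) (hζ : Measurable ζ) (a b : Fin 2 ⊕ Fin 2) :
    Measurable fun x => nullSymbol m ε j (η x) (ζ x) a b := by
  have hu : Measurable fun x => unitFreq m (η x) := (measurable_unitFreq m).comp hη
  have hv : Measurable fun x => unitFreq m (ζ x) := (measurable_unitFreq m).comp hζ
  have huk : ∀ k, Measurable fun x => unitFreq m (η x) k :=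
    fun k => (measurable_unitFreq_apply m k).comp hη
  have hvk : ∀ k, Measurable fun x => unitFreq m (ζ x) k :=
    fun k => (measurable_unitFreq_apply m k).comp hζ
  fin_cases j
  · exact (Complex.measurable_ofReal.comp
      ((hu.norm.mul hv.norm).sub ((hu.inner hv).const_mul ε))).mul_const _
  · exact (measurable_vecDot_apply (fun k =>
      ((huk k).mul hv.norm).sub (((hvk k).mul hu.norm).const_mul ε)) alpha a b).neg
  · refine (measurable_vecDot_apply (fun k => ?_) spin a b).const_mul _
    have hcross : ∀ k l, Measurable fun x =>
        unitFreq m (η x) k * unitFreq m (ζ x) l - unitFreq m (η x) l * unitFreq m (ζ x) k :=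
      fun k l => ((huk k).mul (hvk l)).sub ((huk l).mul (hvk k))
    simp only [cross_apply]
    fin_cases k
    exacts [hcross 1 2, hcross 2 0, hcross 0 1]

theorem measurable_mulVec {X : Type*} [MeasurableSpace X] {M : X → Mat4}
    {v : X → Fin 2 ⊕ Fin 2 → ℂ} (hM : ∀ a b, Measurable fun x => M x a b) (hv : Measurable v) :
    Measurable fun x => M x *ᵥ v x := by
  refine measurable_pi_lambda _ fun a => ?_
  simp only [Matrix.mulVec, dotProduct]
  fun_prop

theorem measurable_spinorInner {X : Type*} [MeasurableSpace X] {v w : X → Fin 2 ⊕ Fin 2 → ℂ}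
    (hv : Measurable v) (hw : Measurable w) : Measurable fun x => spinorInner (v x) (w x) := by
  have hstar : Measurable (star : ℂ → ℂ) := continuous_star.measurable
  simp only [spinorInner, dotProduct, Pi.star_apply]
  fun_prop

theorem measurable_amplitude (χ : Cutoff) (m ε μ : ℝ) (j : Fin 3) {F G : E3 → Spinor}
    (hF : Measurable F) (hG : Measurable G) :
    Measurable (Function.uncurry (amplitude χ m ε μ j F G)) := by
  have hN := measurable_nullSymbol_apply m ε j (X := E3 × E3) measurable_snd
    (measurable_snd.fun_sub measurable_fst)
  have hFv : Measurable fun p : E3 × E3 => (F p.2).ofLp := by fun_prop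
  have hGv : Measurable fun p : E3 × E3 => (G (p.2 - p.1)).ofLp := by fun_prop
  have hβF := measurable_mulVec (M := fun _ => beta) (fun _ _ => measurable_const) hFv
  have hS := measurable_spinorInner hβF (measurable_mulVec hN hGv)
  exact ((measurable_rho_norm χ μ).comp measurable_fst).mul hS

theorem ne_zero_of_amplitude_ne_zero {χ : Cutoff} {m ε μ : ℝ} {j : Fin 3} {F G : E3 → Spinor}
    {ξ η : E3} (h : amplitude χ m ε μ j F G ξ η ≠ 0) :
    rho χ μ ‖ξ‖ ≠ 0 ∧ F η ≠ 0 ∧ G (η - ξ) ≠ 0 := by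
  refine ⟨fun h0 => h ?_, fun h0 => h ?_, fun h0 => h ?_⟩ <;> simp [amplitude, h0, spinorInner]

end Amplitude

section Bilinear

theorem lintegral_lintegral_mul_sub {V : Type*} [AddGroup V] [MeasurableSpace V]
    [MeasurableAdd₂ V] [MeasurableNeg V] (ν : Measure V) [SFinite ν] [ν.IsAddLeftInvariant]
    [ν.IsNegInvariant] {u v : V → ENNReal} (hu : Measurable u) (hv : Measurable v) :
    ∫⁻ ξ, ∫⁻ η, u η * v (η - ξ) ∂ν ∂ν = (∫⁻ η, u η ∂ν) * ∫⁻ ζ, v ζ ∂ν := by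
  have hsub : Measurable fun p : V × V => p.2 - p.1 := by
    simpa only [sub_eq_add_neg] using measurable_snd.fun_add measurable_fst.fun_neg
  rw [lintegral_lintegral_swap
    ((hu.comp measurable_snd).mul (hv.comp hsub)).aemeasurable, ← lintegral_mul_const _ hu]
  refine lintegral_congr fun η => ?_
  have hη : Measurable fun ξ => v (η - ξ) := hv.comp (hsub.comp measurable_prodMk_right)
  rw [lintegral_const_mul _ hη, lintegral_sub_left_eq_self]

/-- `h` is the amplitude of an interaction of two waves whose squared Fourier transforms have the
sizes `u` and `v`, and it is small where the phase is nearly stationary: `|h|²` carries one factor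
`|∇φ|` of the phase. -/
structure NullDominated (m ε κ : ℝ) (u v : E3 → ENNReal) (h : E3 → E3 → ℂ) : Prop where
  measurable_left : Measurable u
  measurable_right : Measurable v
  measurable : Measurable (Function.uncurry h)
  lintegral_left_ne_top : ∫⁻ η, u η ≠ ⊤
  lintegral_right_ne_top : ∫⁻ η, v η ≠ ⊤
  bound : ∀ ξ η, ‖h ξ η‖ₑ ^ 2 ≤
    ENNReal.ofReal κ * ENNReal.ofReal (phaseGrad m ε ξ η) * (u η * v (η - ξ))

variable {m ε κ : ℝ} {u v : E3 → ENNReal} {h : E3 → E3 → ℂ}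

theorem phaseGrad_le (m : ℝ) (hε : ε = 1 ∨ ε = -1) (ξ η : E3) : phaseGrad m ε ξ η ≤ 6 := by
  have hunit : ∀ (x : E3) (k : Fin 3), |unitFreq m x k| ≤ 1 := fun x k =>
    (PiLp.norm_apply_le (unitFreq m x) k).trans (norm_unitFreq_le_one m x)
  have hk : ∀ k, |phaseDeriv m ε k ξ η| ≤ 2 := fun k => by
    have h₁ := abs_le.1 (hunit η k)
    have h₂ := abs_le.1 (hunit (η - ξ) k)
    rw [phaseDeriv, abs_le]
    rcases hε with rfl | rfl <;> constructor <;> linarith [h₁.1, h₁.2, h₂.1, h₂.2]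
  rw [phaseGrad, Fin.sum_univ_three]
  linarith [hk 0, hk 1, hk 2]

theorem NullDominated.lintegral_enorm_sq_le (hε : ε = 1 ∨ ε = -1)
    (hd : NullDominated m ε κ u v h) (ξ : E3) :
    (∫⁻ η, ‖h ξ η‖ₑ) ^ 2 ≤ ENNReal.ofReal κ * 6 * ((∫⁻ η, u η) * ∫⁻ η, v η) := by
  have hu := hd.measurable_left
  have hv := hd.measurable_right
  rw [← lintegral_sub_right_eq_self v ξ, ← mul_assoc, ← lintegral_const_mul _ hu]
  refine lintegral_sq_le_of_sq_le_mul (by fun_prop) (by fun_prop) fun η => ?_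
  refine (hd.bound ξ η).trans ?_
  rw [← mul_assoc]
  gcongr
  exact ENNReal.ofReal_le_of_le_toReal (phaseGrad_le m hε ξ η)

theorem NullDominated.integrable (hε : ε = 1 ∨ ε = -1) (hd : NullDominated m ε κ u v h)
    (ξ : E3) : Integrable (h ξ) := by
  refine ⟨hd.measurable.of_uncurry_left.aestronglyMeasurable, ?_⟩
  have hfin : ENNReal.ofReal κ * 6 * ((∫⁻ η, u η) * ∫⁻ η, v η) < ⊤ :=
    ENNReal.mul_lt_top (ENNReal.mul_lt_top ENNReal.ofReal_lt_top ENNReal.ofNat_lt_top)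
      (ENNReal.mul_lt_top hd.lintegral_left_ne_top.lt_top hd.lintegral_right_ne_top.lt_top)
  rw [hasFiniteIntegral_iff_enorm]
  exact (ENNReal.pow_lt_top_iff.1 ((hd.lintegral_enorm_sq_le hε ξ).trans_lt hfin)).resolve_right
    two_ne_zero

theorem measurable_interaction (hh : Measurable (Function.uncurry h)) :
    Measurable (interaction m ε h) := by
  have hpair : Measurable fun q : (ℝ × E3) × E3 => (q.1.2, q.2) := by fun_prop
  have hφ := (measurable_phase m ε).comp hpair
  have hh' := hh.comp hpair
  simp only [Function.comp_def, Function.uncurry_apply_pair] at hφ hh'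
  have hint : Measurable fun q : (ℝ × E3) × E3 =>
      Complex.exp (-Complex.I * ((q.1.1 * phase m ε q.1.2 q.2 : ℝ) : ℂ)) * h q.1.2 q.2 := by
    fun_prop
  exact hint.stronglyMeasurable.integral_prod_right'.measurable

theorem NullDominated.lintegral_time_enorm_interaction_sq_le (hε : ε = 1 ∨ ε = -1)
    (hd : NullDominated m ε κ u v h) {ξ c : E3} {R : ℝ} (hR : 0 ≤ R)
    (hc : ∀ η, h ξ η ≠ 0 → η ∈ cube c R) :
    ∫⁻ t : ℝ, ‖interaction m ε h (t, ξ)‖ₑ ^ 2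
      ≤ ENNReal.ofReal (12 * Real.pi * R ^ 2) * ENNReal.ofReal κ * ∫⁻ η, u η * v (η - ξ) := by
  have hu := hd.measurable_left
  have hv := hd.measurable_right
  have hgrad : Measurable fun η => ENNReal.ofReal (phaseGrad m ε ξ η) :=
    (measurable_phaseGrad m ε).of_uncurry_left.ennreal_ofReal
  refine (lintegral_enorm_oscillatoryIntegral_sq_le (measurable_phase m ε).of_uncurry_left
    (w := (cube c R).indicator fun η => ENNReal.ofReal κ * ENNReal.ofReal (phaseGrad m ε ξ η))
    ((hgrad.const_mul _).indicator (measurableSet_cube c R))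
    (M := ENNReal.ofReal κ * (6 * ENNReal.ofReal (R ^ 2))) (fun S hS => ?_)
    (hd.integrable hε ξ) (k := fun η => u η * v (η - ξ)) (by fun_prop) fun η => ?_).trans_eq ?_
  · rw [setLIntegral_indicator (measurableSet_cube c R), lintegral_const_mul _ hgrad, mul_assoc]
    gcongr
    exact setLIntegral_phaseGrad_le m hε ξ c hR hS
  · by_cases h0 : h ξ η = 0
    · simp [h0]
    · rw [Set.indicator_of_mem (hc η h0)]
      exact hd.bound ξ η
  · have hconst : 12 * Real.pi * R ^ 2 = 2 * Real.pi * (6 * R ^ 2) := by ring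
    rw [hconst, ENNReal.ofReal_mul Real.two_pi_pos.le, ENNReal.ofReal_mul (p := 6) (by simp),
      ENNReal.ofReal_ofNat]
    ring

theorem NullDominated.lintegral_enorm_interaction_sq_le (hε : ε = 1 ∨ ε = -1)
    (hd : NullDominated m ε κ u v h) {c : E3 → E3} {R : ℝ} (hR : 0 ≤ R)
    (hc : ∀ ξ η, h ξ η ≠ 0 → η ∈ cube (c ξ) R) :
    ∫⁻ p, ‖interaction m ε h p‖ₑ ^ 2
      ≤ ENNReal.ofReal (12 * Real.pi * R ^ 2) * ENNReal.ofReal κ *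
        ((∫⁻ η, u η) * ∫⁻ η, v η) := by
  have hu := hd.measurable_left
  have hv := hd.measurable_right
  rw [Measure.volume_eq_prod, lintegral_prod_symm _
    ((measurable_interaction hd.measurable).enorm.pow_const 2).aemeasurable]
  calc ∫⁻ ξ, ∫⁻ t, ‖interaction m ε h (t, ξ)‖ₑ ^ 2
      ≤ ∫⁻ ξ, ENNReal.ofReal (12 * Real.pi * R ^ 2) * ENNReal.ofReal κ *
          ∫⁻ η, u η * v (η - ξ) :=
        lintegral_mono fun ξ => hd.lintegral_time_enorm_interaction_sq_le hε hR (hc ξ)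
    _ = _ := by
        rw [lintegral_const_mul _ (Measurable.lintegral_prod_right'
          (f := fun p : E3 × E3 => u p.2 * v (p.2 - p.1)) (by fun_prop)),
          lintegral_lintegral_mul_sub _ hu hv]

end Bilinear

section FiniteOverlap

variable {ι X : Type*} [MeasurableSpace X] (ν : Measure X) (s : Finset ι)

theorem sum_sq_le_of_sq_le_mul {x a b : ι → ENNReal} (h : ∀ i, x i ^ 2 ≤ a i * b i) :
    (∑ i ∈ s, x i) ^ 2 ≤ (∑ i ∈ s, a i) * ∑ i ∈ s, b i := by
  let _ : MeasurableSpace s := ⊤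
  have hcount := lintegral_sq_le_of_sq_le_mul (ν := (Measure.count : Measure s))
    (h := fun i => x i) (u := fun i => a i) (v := fun i => b i)
    measurable_from_top.aemeasurable measurable_from_top.aemeasurable fun i => h i
  simpa only [lintegral_count, tsum_fintype, Finset.sum_coe_sort s] using hcount

theorem lintegral_enorm_sum_sq_le {E : Type*} [NormedAddCommGroup E] {V : ι → X → E}
    (hV : ∀ i, AEStronglyMeasurable (V i) ν) {a b : ι → ENNReal}
    (h : ∀ i, ∫⁻ x, ‖V i x‖ₑ ^ 2 ∂ν ≤ a i * b i) :
    ∫⁻ x, ‖∑ i ∈ s, V i x‖ₑ ^ 2 ∂ν ≤ (∑ i ∈ s, a i) * ∑ i ∈ s, b i := by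
  simp only [← eLpNorm_two_sq] at h ⊢
  simp only [← Finset.sum_apply]
  exact (pow_le_pow_left' (eLpNorm_sum_le (fun i _ => hV i) one_le_two) 2).trans
    (sum_sq_le_of_sq_le_mul s h)

open Classical in
theorem sum_lintegral_indicator_le {A : ι → Set X} (hA : ∀ i, MeasurableSet (A i)) {N : ℕ}
    (hN : ∀ x, (s.filter fun i => x ∈ A i).card ≤ N) {u : X → ENNReal} (hu : Measurable u) :
    ∑ i ∈ s, ∫⁻ x, (A i).indicator u x ∂ν ≤ N * ∫⁻ x, u x ∂ν := by
  rw [← lintegral_finsetSum _ fun i _ => hu.indicator (hA i), ← lintegral_const_mul _ hu]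
  refine lintegral_mono fun x => ?_
  simp only [Set.indicator_apply]
  rw [← Finset.sum_filter, Finset.sum_const, nsmul_eq_mul]
  gcongr
  exact hN x

end FiniteOverlap

section Cells

/-- The index of the cell containing `η` in the lattice of cubes of side `μ`. -/
def cellIndex (μ : ℝ) (η : E3) (k : Fin 3) : ℤ := ⌊η k / μ⌋

/-- The cell with index `n` in the lattice of cubes of side `μ`. -/
def cell (μ : ℝ) (n : Fin 3 → ℤ) : Set E3 := {η | cellIndex μ η = n}

/-- The `5³` cells around the cell with index `n`: they contain every `η - ξ` with `η` in that
cell and `|ξ| ≤ 2 μ`. -/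
def cellNhd (μ : ℝ) (n : Fin 3 → ℤ) : Set E3 := {ζ | ∀ k, |cellIndex μ ζ k - n k| ≤ 2}

theorem measurable_cellIndex (μ : ℝ) : Measurable (cellIndex μ) :=
  measurable_pi_lambda _ fun k =>
    Int.measurable_floor.comp ((by fun_prop : Measurable fun η : E3 => η k).div_const μ)

theorem measurableSet_cell (μ : ℝ) (n : Fin 3 → ℤ) : MeasurableSet (cell μ n) :=
  measurable_cellIndex μ (measurableSet_singleton n)

theorem measurableSet_cellNhd (μ : ℝ) (n : Fin 3 → ℤ) : MeasurableSet (cellNhd μ n) :=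
  measurable_cellIndex μ (Set.to_countable {p : Fin 3 → ℤ | ∀ k, |p k - n k| ≤ 2}).measurableSet

variable {μ : ℝ}

theorem cell_subset_cube (hμ : 0 < μ) (n : Fin 3 → ℤ) :
    cell μ n ⊆ cube (WithLp.toLp 2 fun k => μ * n k) μ := by
  intro η hη k
  have hk : ⌊η k / μ⌋ = n k := congrFun hη k
  obtain ⟨hle, hlt⟩ := Int.floor_eq_iff.1 hk
  rw [le_div_iff₀ hμ] at hle
  rw [div_lt_iff₀ hμ] at hlt
  simp only
  constructor <;> linarith

theorem sub_mem_cellNhd (hμ : 0 < μ) {n : Fin 3 → ℤ} {ξ η : E3} (hξ : ‖ξ‖ ≤ 2 * μ)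
    (hη : η ∈ cell μ n) : η - ξ ∈ cellNhd μ n := by
  intro k
  have hk : ⌊η k / μ⌋ = n k := congrFun hη k
  have hsub : cellIndex μ (η - ξ) k = ⌊η k / μ - ξ k / μ⌋ := by simp [cellIndex, sub_div]
  have hξk := abs_le.1 ((PiLp.norm_apply_le ξ k).trans hξ)
  have hle : ξ k / μ ≤ 2 := (div_le_iff₀ hμ).2 hξk.2
  have hge : -2 ≤ ξ k / μ := (le_div_iff₀ hμ).2 (by linarith [hξk.1])
  rw [hsub, ← hk, abs_le, neg_le_sub_iff_le_add, sub_le_iff_le_add', ← Int.floor_add_ofNat,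
    ← Int.floor_add_ofNat]
  exact ⟨Int.floor_mono (by linarith), Int.floor_mono (by linarith)⟩

theorem exists_finset_cellIndex_mem (hμ : 0 < μ) (L : ℝ) :
    ∃ s : Finset (Fin 3 → ℤ), ∀ η : E3, ‖η‖ ≤ L → cellIndex μ η ∈ s := by
  refine ⟨Fintype.piFinset fun _ => Finset.Icc ⌊-L / μ⌋ ⌊L / μ⌋, fun η hη => ?_⟩
  refine Fintype.mem_piFinset.2 fun k => ?_
  have hηk := abs_le.1 ((PiLp.norm_apply_le η k).trans hη)
  exact Finset.mem_Icc.2 ⟨Int.floor_mono (by gcongr; exact hηk.1),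
    Int.floor_mono (by gcongr; exact hηk.2)⟩

open Classical in
theorem card_filter_mem_cell_le (s : Finset (Fin 3 → ℤ)) (η : E3) :
    (s.filter fun n => η ∈ cell μ n).card ≤ 1 :=
  Finset.card_le_one.2 fun _ hn _ hn' =>
    (Finset.mem_filter.1 hn).2.symm.trans (Finset.mem_filter.1 hn').2

open Classical in
theorem card_filter_mem_cellNhd_le (s : Finset (Fin 3 → ℤ)) (ζ : E3) :
    (s.filter fun n => ζ ∈ cellNhd μ n).card ≤ 125 := by
  have hsub : (s.filter fun n => ζ ∈ cellNhd μ n) ⊆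
      Fintype.piFinset fun k => Finset.Icc (cellIndex μ ζ k - 2) (cellIndex μ ζ k + 2) := by
    intro n hn
    refine Fintype.mem_piFinset.2 fun k => Finset.mem_Icc.2 ?_
    have hk := abs_le.1 ((Finset.mem_filter.1 hn).2 k)
    constructor <;> linarith [hk.1, hk.2]
  refine (Finset.card_le_card hsub).trans_eq ?_
  have hcard : ∀ k, (Finset.Icc (cellIndex μ ζ k - 2) (cellIndex μ ζ k + 2)).card = 5 := fun k => by
    rw [Int.card_Icc]
    lia
  simp only [Fintype.card_piFinset, hcard, Finset.prod_const, Finset.card_univ, Fintype.card_fin]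
  norm_num

theorem sum_indicator_cell_apply {E : Type*} [AddCommMonoid E] {s : Finset (Fin 3 → ℤ)}
    {f : E3 → E} (hs : ∀ η, f η ≠ 0 → cellIndex μ η ∈ s) (η : E3) :
    ∑ n ∈ s, (cell μ n).indicator f η = f η := by
  classical
  simp only [Set.indicator_apply, cell, Set.mem_ofPred_eq, Finset.sum_ite_eq, ite_eq_left_iff]
  exact fun hη => (not_imp_comm.1 (hs η) hη).symm

end Cells

section Orthogonality

variable {m ε κ μ : ℝ} {u v : E3 → ENNReal} {h : E3 → E3 → ℂ}

theorem interaction_eq_sum_cell (hint : ∀ ξ, Integrable (h ξ)) {s : Finset (Fin 3 → ℤ)}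
    (hs : ∀ ξ η, h ξ η ≠ 0 → cellIndex μ η ∈ s) (p : ℝ × E3) :
    interaction m ε h p
      = ∑ n ∈ s, interaction m ε (fun ξ => (cell μ n).indicator (h ξ)) p := by
  simp only [interaction, oscillatoryIntegral]
  have hφ : Measurable (phase m ε p.2) := (measurable_phase m ε).of_uncurry_left
  rw [← integral_finsetSum _ fun n _ =>
    ((hint p.2).indicator (measurableSet_cell μ n)).bdd_mul (c := 1)
      (by fun_prop) (Filter.Eventually.of_forall fun η => (norm_exp_neg_I_mul_ofReal _).le)]
  refine integral_congr_ae (Filter.Eventually.of_forall fun η => ?_)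
  simp only [← Finset.mul_sum, sum_indicator_cell_apply (hs p.2)]

theorem NullDominated.indicator_cell (hd : NullDominated m ε κ u v h) (hμ : 0 < μ)
    (hout : ∀ ξ η, h ξ η ≠ 0 → ‖ξ‖ ≤ 2 * μ) (n : Fin 3 → ℤ) :
    NullDominated m ε κ ((cell μ n).indicator u) ((cellNhd μ n).indicator v)
      fun ξ => (cell μ n).indicator (h ξ) where
  measurable_left := hd.measurable_left.indicator (measurableSet_cell μ n)
  measurable_right := hd.measurable_right.indicator (measurableSet_cellNhd μ n)
  measurable := hd.measurable.indicator (measurable_snd (measurableSet_cell μ n))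
  lintegral_left_ne_top :=
    ne_top_of_le_ne_top hd.lintegral_left_ne_top (lintegral_mono (Set.indicator_le_self _ _))
  lintegral_right_ne_top :=
    ne_top_of_le_ne_top hd.lintegral_right_ne_top (lintegral_mono (Set.indicator_le_self _ _))
  bound ξ η := by
    by_cases hη : η ∈ cell μ n
    · by_cases h0 : h ξ η = 0
      · simp [hη, h0]
      · simpa only [Set.indicator_of_mem hη,
          Set.indicator_of_mem (sub_mem_cellNhd hμ (hout ξ η h0) hη)] using hd.bound ξ η
    · simp [hη]

-- Outputs of frequency `≲ μ` only see pairs of cells of side `μ` at distance `≲ μ`, and every cell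
-- lies in boundedly many such pairs.
theorem NullDominated.lintegral_enorm_interaction_sq_le_of_output (hε : ε = 1 ∨ ε = -1)
    (hd : NullDominated m ε κ u v h) (hμ : 0 < μ) (hout : ∀ ξ η, h ξ η ≠ 0 → ‖ξ‖ ≤ 2 * μ)
    {L : ℝ} (hL : ∀ ξ η, h ξ η ≠ 0 → ‖η‖ ≤ L) :
    ∫⁻ p, ‖interaction m ε h p‖ₑ ^ 2
      ≤ 125 * (ENNReal.ofReal (12 * Real.pi * μ ^ 2) * ENNReal.ofReal κ *
        ((∫⁻ η, u η) * ∫⁻ η, v η)) := by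
  obtain ⟨s, hs⟩ := exists_finset_cellIndex_mem hμ L
  have hloc := hd.indicator_cell hμ hout
  have hcube : ∀ n ξ η, (cell μ n).indicator (h ξ) η ≠ 0 →
      η ∈ cube (WithLp.toLp 2 fun k => μ * n k) μ := fun n ξ η hne =>
    cell_subset_cube hμ n (Set.mem_of_indicator_ne_zero hne)
  have hu := sum_lintegral_indicator_le volume s (measurableSet_cell μ)
    (card_filter_mem_cell_le s) hd.measurable_left
  have hv := sum_lintegral_indicator_le volume s (measurableSet_cellNhd μ)
    (card_filter_mem_cellNhd_le s) hd.measurable_right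
  simp only [interaction_eq_sum_cell (hd.integrable hε) fun ξ η hne => hs η (hL ξ η hne)]
  calc _ ≤ (∑ n ∈ s, ENNReal.ofReal (12 * Real.pi * μ ^ 2) * ENNReal.ofReal κ *
          ∫⁻ η, (cell μ n).indicator u η) * ∑ n ∈ s, ∫⁻ η, (cellNhd μ n).indicator v η := by
        refine lintegral_enorm_sum_sq_le volume s
          (fun n => (measurable_interaction (hloc n).measurable).aestronglyMeasurable) fun n => ?_
        rw [mul_assoc]
        exact (hloc n).lintegral_enorm_interaction_sq_le hε hμ.le (hcube n)
    _ ≤ (ENNReal.ofReal (12 * Real.pi * μ ^ 2) * ENNReal.ofReal κ * ((1 : ℕ) * ∫⁻ η, u η)) *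
          ((125 : ℕ) * ∫⁻ η, v η) := by
        rw [← Finset.mul_sum]
        gcongr
    _ = _ := by
        push_cast
        ring

end Orthogonality

section InverseFourier

theorem lintegral_enorm_invFourier_sq {G : E3 → ℂ} (h1 : Integrable G) (h2 : MemLp G 2 volume) :
    ∫⁻ x, ‖invFourier G x‖ₑ ^ 2 =
      ENNReal.ofReal (((2 * Real.pi) ^ 3)⁻¹) * ∫⁻ ξ, ‖G ξ‖ₑ ^ 2 := by
  have hc : ‖((2 * Real.pi : ℝ) : ℂ)⁻¹ ^ 3‖ₑ ^ 2 = ENNReal.ofReal (((2 * Real.pi) ^ 3)⁻¹ ^ 2) := by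
    rw [← ofReal_norm, ← ENNReal.ofReal_pow (norm_nonneg _), norm_pow, norm_inv, Complex.norm_real,
      Real.norm_of_nonneg Real.two_pi_pos.le, inv_pow]
  simp only [invFourier, enorm_mul, mul_pow (M := ENNReal), hc]
  rw [lintegral_const_mul' _ _ ENNReal.ofReal_ne_top, lintegral_enorm_integral_exp_inner_sq h1 h2,
    finrank_euclideanSpace_fin, ← mul_assoc, ← ENNReal.ofReal_mul (by positivity)]
  congr 2
  field_simp

variable {V : ℝ × E3 → ℂ}

theorem measurable_invFourier_slice (hV : Measurable V) :
    Measurable fun p : ℝ × E3 => invFourier (fun ξ => V (p.1, ξ)) p.2 := by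
  have hint : Measurable fun q : (ℝ × E3) × E3 =>
      Complex.exp (Complex.I * ((inner ℝ q.1.2 q.2 : ℝ) : ℂ)) * V (q.1.1, q.2) := by
    fun_prop
  exact hint.stronglyMeasurable.integral_prod_right'.measurable.const_mul _

theorem lintegral_enorm_invFourier_slice_sq (hV : Measurable V)
    (h1 : ∀ t, Integrable fun ξ => V (t, ξ)) (h2 : ∀ t, MemLp (fun ξ => V (t, ξ)) 2 volume) :
    ∫⁻ p : ℝ × E3, ‖invFourier (fun ξ => V (p.1, ξ)) p.2‖ₑ ^ 2 =
      ENNReal.ofReal (((2 * Real.pi) ^ 3)⁻¹) * ∫⁻ p, ‖V p‖ₑ ^ 2 := by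
  have hV₂ : Measurable fun p => ‖V p‖ₑ ^ 2 := hV.enorm.pow_const 2
  have hF₂ : Measurable fun p : ℝ × E3 => ‖invFourier (fun ξ => V (p.1, ξ)) p.2‖ₑ ^ 2 :=
    (measurable_invFourier_slice hV).enorm.pow_const 2
  rw [Measure.volume_eq_prod, lintegral_prod _ hF₂.aemeasurable, lintegral_prod _ hV₂.aemeasurable,
    ← lintegral_const_mul _ hV₂.lintegral_prod_right']
  refine lintegral_congr fun t => ?_
  dsimp only
  exact lintegral_enorm_invFourier_sq (h1 t) (h2 t)

end InverseFourier

section SpaceTime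

variable {m ε κ : ℝ} {u v : E3 → ENNReal} {h : E3 → E3 → ℂ}

theorem interaction_eq_zero {p : ℝ × E3} (hp : ∀ η, h p.2 η = 0) : interaction m ε h p = 0 := by
  simp only [interaction, oscillatoryIntegral, hp, mul_zero, integral_zero]

theorem NullDominated.enorm_interaction_sq_le (hε : ε = 1 ∨ ε = -1)
    (hd : NullDominated m ε κ u v h) (p : ℝ × E3) :
    ‖interaction m ε h p‖ₑ ^ 2 ≤ ENNReal.ofReal κ * 6 * ((∫⁻ η, u η) * ∫⁻ η, v η) := by
  refine le_trans ?_ (hd.lintegral_enorm_sq_le hε p.2)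
  gcongr
  refine (enorm_integral_le_lintegral_enorm _).trans_eq (lintegral_congr fun η => ?_)
  rw [enorm_mul, ← ofReal_norm, norm_exp_neg_I_mul_ofReal, ENNReal.ofReal_one, one_mul]

theorem NullDominated.exists_norm_interaction_le (hε : ε = 1 ∨ ε = -1)
    (hd : NullDominated m ε κ u v h) : ∃ B : ℝ, ∀ p, ‖interaction m ε h p‖ ≤ B := by
  have hfin : ENNReal.ofReal κ * 6 * ((∫⁻ η, u η) * ∫⁻ η, v η) ≠ ⊤ :=
    ENNReal.mul_ne_top (ENNReal.mul_ne_top ENNReal.ofReal_ne_top ENNReal.ofNat_ne_top)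
      (ENNReal.mul_ne_top hd.lintegral_left_ne_top hd.lintegral_right_ne_top)
  refine ⟨√(ENNReal.ofReal κ * 6 * ((∫⁻ η, u η) * ∫⁻ η, v η)).toReal,
    fun p => Real.le_sqrt_of_sq_le ?_⟩
  have hp := hd.enorm_interaction_sq_le hε p
  rw [← ofReal_norm, ← ENNReal.ofReal_pow (norm_nonneg _)] at hp
  exact (ENNReal.ofReal_le_iff_le_toReal hfin).1 hp

theorem NullDominated.memLp_interaction (hε : ε = 1 ∨ ε = -1) (hd : NullDominated m ε κ u v h)
    {r : ℝ} (hr : ∀ ξ η, h ξ η ≠ 0 → ‖ξ‖ ≤ r) (t : ℝ) (q : ENNReal) :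
    MemLp (fun ξ => interaction m ε h (t, ξ)) q volume := by
  obtain ⟨B, hB⟩ := hd.exists_norm_interaction_le hε
  have hsupp : (Function.support fun ξ => interaction m ε h (t, ξ)) ⊆ Metric.closedBall 0 r := by
    refine Function.support_subset_iff'.2 fun ξ hξ => interaction_eq_zero fun η => ?_
    exact not_imp_comm.1 (hr ξ η) (by simpa using hξ)
  rw [← Set.indicator_eq_self.2 hsupp]
  exact memLp_indicator_of_bound
    ((measurable_interaction hd.measurable).comp measurable_prodMk_left).aestronglyMeasurable
    Metric.isClosed_closedBall.measurableSet measure_closedBall_lt_top.ne (fun ξ _ => hB (t, ξ)) q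

theorem NullDominated.lintegral_enorm_invFourier_interaction_sq (hε : ε = 1 ∨ ε = -1)
    (hd : NullDominated m ε κ u v h) {r : ℝ} (hr : ∀ ξ η, h ξ η ≠ 0 → ‖ξ‖ ≤ r) :
    ∫⁻ p : ℝ × E3, ‖invFourier (fun ξ => interaction m ε h (p.1, ξ)) p.2‖ₑ ^ 2 =
      ENNReal.ofReal (((2 * Real.pi) ^ 3)⁻¹) * ∫⁻ p, ‖interaction m ε h p‖ₑ ^ 2 :=
  lintegral_enorm_invFourier_slice_sq (measurable_interaction hd.measurable)
    (fun t => memLp_one_iff_integrable.1 (hd.memLp_interaction hε hr t 1))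
    fun t => hd.memLp_interaction hε hr t 2

end SpaceTime

section Estimates

variable {χ : Cutoff} {m ε μ c δ l₁ l₂ A B : ℝ} {j : Fin 3} {f g : L2} {F G : E3 → Spinor}

theorem angular_le_mul_phaseGrad (hε : ε = 1 ∨ ε = -1) (hδ : 0 ≤ δ) {ξ η : E3}
    (h : angular m ε η (η - ξ) ≤ δ ^ 2) :
    angular m ε η (η - ξ) ≤ δ * phaseGrad m ε ξ η := by
  have h0 := angular_nonneg (m := m) hε η (η - ξ)
  refine le_of_sq_le_sq ?_ (mul_nonneg hδ (phaseGrad_nonneg m ε ξ η))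
  calc angular m ε η (η - ξ) ^ 2 = angular m ε η (η - ξ) * angular m ε η (η - ξ) := sq _
    _ ≤ δ ^ 2 * phaseGrad m ε ξ η ^ 2 := by
        gcongr
        linarith [two_mul_angular_le_phaseGrad_sq (m := m) hε ξ η]
    _ = _ := (mul_pow _ _ 2).symm

theorem norm_amplitude_sq_le (hε : ε = 1 ∨ ε = -1) (hc : ∀ s, |rho χ μ s| ≤ c) (hδ : 0 ≤ δ)
    {ξ η : E3} (h : angular m ε η (η - ξ) ≤ δ ^ 2) :
    ‖amplitude χ m ε μ j F G ξ η‖ ^ 2 ≤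
      1536 * c ^ 2 * δ * phaseGrad m ε ξ η * (‖F η‖ ^ 2 * ‖G (η - ξ)‖ ^ 2) := by
  rw [amplitude, norm_mul, mul_pow, Complex.norm_real, Real.norm_eq_abs]
  calc _ ≤ c ^ 2 * (1536 * angular m ε η (η - ξ) * ‖F η‖ ^ 2 * ‖G (η - ξ)‖ ^ 2) := by
        gcongr
        · exact hc _
        · exact norm_spinorInner_nullSymbol_sq_le hε j η (η - ξ) (F η) (G (η - ξ))
    _ ≤ c ^ 2 * (1536 * (δ * phaseGrad m ε ξ η) * ‖F η‖ ^ 2 * ‖G (η - ξ)‖ ^ 2) := by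
        gcongr
        exact angular_le_mul_phaseGrad hε hδ h
    _ = _ := by ring

theorem nullDominated_amplitude (hε : ε = 1 ∨ ε = -1) (hc : ∀ s, |rho χ μ s| ≤ c) (hδ : 0 ≤ δ)
    (hFm : Measurable F) (hGm : Measurable G) (hF : ∫⁻ η, ‖F η‖ₑ ^ 2 ≠ ⊤)
    (hG : ∫⁻ η, ‖G η‖ₑ ^ 2 ≠ ⊤)
    (hang : ∀ ξ η, amplitude χ m ε μ j F G ξ η ≠ 0 → angular m ε η (η - ξ) ≤ δ ^ 2) :
    NullDominated m ε (1536 * c ^ 2 * δ) (fun η => ‖F η‖ₑ ^ 2) (fun η => ‖G η‖ₑ ^ 2)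
      (amplitude χ m ε μ j F G) where
  measurable_left := hFm.enorm.pow_const 2
  measurable_right := hGm.enorm.pow_const 2
  measurable := measurable_amplitude χ m ε μ j hFm hGm
  lintegral_left_ne_top := hF
  lintegral_right_ne_top := hG
  bound ξ η := by
    by_cases h0 : amplitude χ m ε μ j F G ξ η = 0
    · simp [h0]
    have hP := phaseGrad_nonneg m ε ξ η
    have h := ENNReal.ofReal_le_ofReal (norm_amplitude_sq_le (j := j) (F := F) (G := G) hε hc hδ
      (hang ξ η h0))
    rwa [ENNReal.ofReal_mul (by positivity), ENNReal.ofReal_mul (by positivity),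
      ENNReal.ofReal_mul (p := ‖F η‖ ^ 2) (by positivity), ENNReal.ofReal_pow (norm_nonneg _),
      ENNReal.ofReal_pow (norm_nonneg _), ENNReal.ofReal_pow (norm_nonneg _), ofReal_norm,
      ofReal_norm, ofReal_norm] at h

theorem norm_le_of_amplitude_ne_zero (hμ : 1 ≤ μ) (ξ η : E3)
    (h : amplitude χ m ε μ j F G ξ η ≠ 0) : ‖ξ‖ ≤ 2 * μ :=
  le_two_mul_of_rho_ne_zero χ hμ (norm_nonneg ξ) (ne_zero_of_amplitude_ne_zero h).1

theorem mem_shell_of_amplitude_ne_zero {ξ η : E3}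
    (h : amplitude χ m ε μ j ((shell l₁).indicator F) ((shell l₂).indicator G) ξ η ≠ 0) :
    η ∈ shell l₁ ∧ η - ξ ∈ shell l₂ :=
  (ne_zero_of_amplitude_ne_zero h).2.imp Set.mem_of_indicator_ne_zero Set.mem_of_indicator_ne_zero

theorem L2Bound_waveNullForm (hε : ε = 1 ∨ ε = -1) (hμ : 1 ≤ μ) (hF : hat f =ᵐ[volume] F)
    (hG : hat g =ᵐ[volume] G) {κ : ℝ}
    (hd : NullDominated m ε κ (fun η => ‖F η‖ₑ ^ 2) (fun η => ‖G η‖ₑ ^ 2)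
      (amplitude χ m ε μ j F G))
    (hA : 0 ≤ A) (hI : ∫⁻ p, ‖interaction m ε (amplitude χ m ε μ j F G) p‖ₑ ^ 2
      ≤ ENNReal.ofReal A * ((∫⁻ η, ‖F η‖ₑ ^ 2) * ∫⁻ η, ‖G η‖ₑ ^ 2))
    (hB : 0 ≤ B) (hAB : (2 * Real.pi) ^ 3 * A ≤ B ^ 2) :
    L2Bound (waveNullForm χ m ε μ j f g) (B * ‖f‖ * ‖g‖) := by
  have heq := funext (waveNullForm_eq_invFourier_interaction χ m ε μ j hF hG)
  have hle : eLpNorm (waveNullForm χ m ε μ j f g) 2 volume ≤ ENNReal.ofReal (B * ‖f‖ * ‖g‖) := by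
    refine (ENNReal.pow_le_pow_left_iff two_ne_zero).1 ?_
    rw [eLpNorm_two_sq, heq, hd.lintegral_enorm_invFourier_interaction_sq hε
      (norm_le_of_amplitude_ne_zero hμ), ← ENNReal.ofReal_pow (by positivity)]
    calc _ ≤ ENNReal.ofReal (((2 * Real.pi) ^ 3)⁻¹) * (ENNReal.ofReal A *
          ((∫⁻ η, ‖F η‖ₑ ^ 2) * ∫⁻ η, ‖G η‖ₑ ^ 2)) := by gcongr
      _ = ENNReal.ofReal (((2 * Real.pi) ^ 3 * A) * (‖f‖ * ‖g‖) ^ 2) := by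
          rw [lintegral_enorm_sq_of_hat_ae_eq hF, lintegral_enorm_sq_of_hat_ae_eq hG,
            ← ENNReal.ofReal_mul (by positivity), ← ENNReal.ofReal_mul (by positivity),
            ← ENNReal.ofReal_mul (by positivity)]
          congr 1
          field_simp
      _ ≤ ENNReal.ofReal (B ^ 2 * (‖f‖ * ‖g‖) ^ 2) := by gcongr
      _ = ENNReal.ofReal ((B * ‖f‖ * ‖g‖) ^ 2) := by ring_nf
  refine ⟨⟨?_, hle.trans_lt ENNReal.ofReal_lt_top⟩, hle⟩
  rw [heq]
  exact (measurable_invFourier_slice (measurable_interaction hd.measurable)).aestronglyMeasurable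

theorem nullDominated_amplitude_shell (hε : ε = 1 ∨ ε = -1) (hc : ∀ s, |rho χ μ s| ≤ c)
    (hμ : 1 ≤ μ) (hf : hat f =ᵐ[volume] (shell l₁).indicator (hat f))
    (hg : hat g =ᵐ[volume] (shell l₂).indicator (hat g)) (hδ : 0 ≤ δ)
    (hang : ∀ ξ η : E3, ‖ξ‖ ≤ 2 * μ → η ∈ shell l₁ → η - ξ ∈ shell l₂ →
      angular m ε η (η - ξ) ≤ δ ^ 2) :
    NullDominated m ε (1536 * c ^ 2 * δ) (fun η => ‖(shell l₁).indicator (hat f) η‖ₑ ^ 2)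
      (fun η => ‖(shell l₂).indicator (hat g) η‖ₑ ^ 2)
      (amplitude χ m ε μ j ((shell l₁).indicator (hat f)) ((shell l₂).indicator (hat g))) :=
  nullDominated_amplitude hε hc hδ ((measurable_hat f).indicator (measurableSet_shell l₁))
    ((measurable_hat g).indicator (measurableSet_shell l₂))
    (lintegral_enorm_sq_of_hat_ae_eq hf ▸ ENNReal.ofReal_ne_top)
    (lintegral_enorm_sq_of_hat_ae_eq hg ▸ ENNReal.ofReal_ne_top) fun ξ η h =>
      hang ξ η (norm_le_of_amplitude_ne_zero hμ ξ η h) (mem_shell_of_amplitude_ne_zero h).1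
        (mem_shell_of_amplitude_ne_zero h).2

theorem add_mem_cube_of_norm_le {ι : Type*} [Fintype ι] {x : EuclideanSpace ℝ ι} {r : ℝ}
    (hx : ‖x‖ ≤ r) (y : EuclideanSpace ℝ ι) :
    y + x ∈ cube (y - WithLp.toLp 2 fun _ => r) (2 * r) := by
  intro k
  have hk := abs_le.1 ((PiLp.norm_apply_le x k).trans hx)
  simp only [PiLp.add_apply, PiLp.sub_apply]
  constructor <;> linarith [hk.1, hk.2]

theorem exists_cube_of_amplitude_shell_ne_zero (χ : Cutoff) (m ε μ l₁ l₂ : ℝ) (j : Fin 3)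
    (F G : E3 → Spinor) : ∃ p : E3 → E3, ∀ ξ η,
      amplitude χ m ε μ j ((shell l₁).indicator F) ((shell l₂).indicator G) ξ η ≠ 0 →
        η ∈ cube (p ξ) (2 * (2 * min l₁ l₂)) := by
  rcases le_total l₁ l₂ with h | h
  · refine ⟨fun _ => 0 - WithLp.toLp 2 fun _ => 2 * l₁, fun ξ η h0 => ?_⟩
    rw [min_eq_left h]
    simpa using add_mem_cube_of_norm_le (mem_shell_of_amplitude_ne_zero h0).1.1 0
  · refine ⟨fun ξ => ξ - WithLp.toLp 2 fun _ => 2 * l₂, fun ξ η h0 => ?_⟩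
    rw [min_eq_right h]
    simpa using add_mem_cube_of_norm_le (mem_shell_of_amplitude_ne_zero h0).2.1 ξ

theorem L2Bound_waveNullForm_min (hε : ε = 1 ∨ ε = -1) (hc : ∀ s, |rho χ μ s| ≤ c)
    (hμ : 1 ≤ μ) (h₁ : 0 ≤ l₁) (h₂ : 0 ≤ l₂)
    (hf : hat f =ᵐ[volume] (shell l₁).indicator (hat f))
    (hg : hat g =ᵐ[volume] (shell l₂).indicator (hat g)) {C : ℝ} (hC : 0 ≤ C)
    (hcC : 192 * ((2 * Real.pi) ^ 4 * (1536 * c ^ 2)) ≤ C ^ 2) :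
    L2Bound (waveNullForm χ m ε μ j f g) (C * min l₁ l₂ * ‖f‖ * ‖g‖) := by
  have hd := nullDominated_amplitude_shell (m := m) (j := j) hε hc hμ hf hg zero_le_two
    fun ξ η _ _ _ => (angular_le_two hε η (η - ξ)).trans (by norm_num)
  obtain ⟨p, hp⟩ := exists_cube_of_amplitude_shell_ne_zero χ m ε μ l₁ l₂ j (hat f) (hat g)
  have hI := hd.lintegral_enorm_interaction_sq_le hε (by positivity) hp
  rw [← ENNReal.ofReal_mul (by positivity)] at hI
  refine L2Bound_waveNullForm hε hμ hf hg hd (by positivity) hI (by positivity) ?_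
  calc _ = 192 * ((2 * Real.pi) ^ 4 * (1536 * c ^ 2)) * min l₁ l₂ ^ 2 := by ring
    _ ≤ C ^ 2 * min l₁ l₂ ^ 2 := by gcongr
    _ = _ := (mul_pow _ _ 2).symm

theorem L2Bound_waveNullForm_output (hε : ε = 1 ∨ ε = -1) (hc : ∀ s, |rho χ μ s| ≤ c)
    (hμ : 1 ≤ μ) (hf : hat f =ᵐ[volume] (shell l₁).indicator (hat f))
    (hg : hat g =ᵐ[volume] (shell l₂).indicator (hat g)) (hδ : 0 ≤ δ)
    (hang : ∀ ξ η : E3, ‖ξ‖ ≤ 2 * μ → η ∈ shell l₁ → η - ξ ∈ shell l₂ →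
      angular m ε η (η - ξ) ≤ δ ^ 2)
    (hB : 0 ≤ B) (hcB : 750 * ((2 * Real.pi) ^ 4 * (1536 * c ^ 2)) * (δ * μ ^ 2) ≤ B ^ 2) :
    L2Bound (waveNullForm χ m ε μ j f g) (B * ‖f‖ * ‖g‖) := by
  have hd := nullDominated_amplitude_shell (m := m) (j := j) hε hc hμ hf hg hδ hang
  have hI := hd.lintegral_enorm_interaction_sq_le_of_output hε (by linarith)
    (norm_le_of_amplitude_ne_zero hμ) fun ξ η h => (mem_shell_of_amplitude_ne_zero h).1.1
  rw [← ENNReal.ofReal_mul (by positivity), ← mul_assoc, ← ENNReal.ofReal_ofNat 125,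
    ← ENNReal.ofReal_mul (by norm_num)] at hI
  refine L2Bound_waveNullForm hε hμ hf hg hd (by positivity) hI hB (hcB.trans_eq' ?_)
  ring

end Estimates

end DiracNull

end

open DiracNull in
theorem lemma4p2_general (χ : Cutoff) (K : ℝ) :
    ∃ C : ℝ, 0 < C ∧ ∀ m μ l₁ l₂ : ℝ, 1 ≤ μ → 1 ≤ l₁ → 1 ≤ l₂ → ∀ (j : Fin 3) (f g : L2),
      (∀ ε : ℝ, ε = 1 ∨ ε = -1 →
        L2Bound (waveNullForm χ m ε μ j (freqProj χ l₁ f) (freqProj χ l₂ g))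
          (C * min l₁ l₂ * ‖freqProj χ l₁ f‖ * ‖freqProj χ l₂ g‖) ∧
        L2Bound (waveNullForm χ m ε μ j (freqProj χ l₁ f) (freqProj χ l₂ g))
          (C * μ * ‖freqProj χ l₁ f‖ * ‖freqProj χ l₂ g‖)) ∧
      (l₁ ≤ K * l₂ →
        L2Bound (waveNullForm χ m 1 μ j (freqProj χ l₁ f) (freqProj χ l₂ g))
          (C * (μ * (μ / l₁) ^ (1 / 2 : ℝ)) * ‖freqProj χ l₁ f‖ * ‖freqProj χ l₂ g‖)) := by
  obtain ⟨c, hc0, hc⟩ := exists_abs_rho_le χ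
  set S : ℝ := (2 * Real.pi) ^ 4 * (1536 * c ^ 2)
  have hS : 0 < S := by positivity
  have hK : 1 ≤ max 1 K := le_max_left _ _
  have hSK : S ≤ S * max 1 K := le_mul_of_one_le_right hS.le hK
  have hC : √(3000 * (S * max 1 K)) ^ 2 = 3000 * (S * max 1 K) := Real.sq_sqrt (by positivity)
  refine ⟨√(3000 * (S * max 1 K)), by positivity, fun m μ l₁ l₂ hμ h₁ h₂ j f g => ?_⟩
  have hf := hat_freqProj_ae_eq_indicator χ h₁ f
  have hg := hat_freqProj_ae_eq_indicator χ h₂ g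
  refine ⟨fun ε hε => ⟨?_, ?_⟩, fun hl => ?_⟩
  · exact L2Bound_waveNullForm_min hε (hc μ) hμ (by linarith) (by linarith) hf hg (by positivity)
      (by linarith)
  · refine L2Bound_waveNullForm_output hε (hc μ) hμ hf hg zero_le_two (fun ξ η _ _ _ =>
      (angular_le_two hε η (η - ξ)).trans (by norm_num)) (by positivity) ?_
    calc 750 * S * (2 * μ ^ 2) = 1500 * S * μ ^ 2 := by ring
      _ ≤ 3000 * (S * max 1 K) * μ ^ 2 := by gcongr; linarith
      _ = _ := by rw [mul_pow √_, hC]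
  · have hl' : l₁ ≤ max 1 K * l₂ := hl.trans (by gcongr; exact le_max_right _ _)
    refine L2Bound_waveNullForm_output (Or.inl rfl) (hc μ) hμ hf hg (by positivity)
      (fun ξ η => angular_one_le_sq_of_mem_shell m hK hμ h₁ h₂ hl') (by positivity) ?_
    calc 750 * S * (4 * max 1 K * (μ / l₁) * μ ^ 2)
        = 3000 * (S * max 1 K) * (μ ^ 2 * (μ / l₁)) := by ring
      _ ≤ _ := by
        rw [mul_pow √_, hC, mul_pow μ, ← Real.sqrt_eq_rpow, Real.sq_sqrt (by positivity)]

open DiracNull in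
theorem lemma4p2 (χ : Cutoff) (m : ℝ) (hm : 0 ≤ m) (K : ℝ) (hK : 1 < K) :
    ∃ C : ℝ, 0 < C ∧ ∀ μ l₁ l₂ : ℝ, IsDyadic μ → IsDyadic l₁ → IsDyadic l₂ →
      1 ≤ μ → 1 ≤ l₁ → 1 ≤ l₂ → ∀ (j : Fin 3) (f g : L2),
      ((NotComparable K l₁ l₂ →
          L2Bound (waveNullForm χ m 1 μ j (freqProj χ l₁ f) (freqProj χ l₂ g))
            (C * (min l₁ l₂) * ‖freqProj χ l₁ f‖ * ‖freqProj χ l₂ g‖)) ∧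
       (Lesssim K μ l₁ → Comparable K l₁ l₂ →
          L2Bound (waveNullForm χ m 1 μ j (freqProj χ l₁ f) (freqProj χ l₂ g))
            (C * (μ * (μ / l₁) ^ (1 / 2 : ℝ)) * ‖freqProj χ l₁ f‖ * ‖freqProj χ l₂ g‖))) ∧
      ((NotComparable K l₁ l₂ →
          L2Bound (waveNullForm χ m (-1) μ j (freqProj χ l₁ f) (freqProj χ l₂ g))
            (C * (min l₁ l₂) * ‖freqProj χ l₁ f‖ * ‖freqProj χ l₂ g‖)) ∧
       (Lesssim K μ l₁ → Comparable K l₁ l₂ →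
          L2Bound (waveNullForm χ m (-1) μ j (freqProj χ l₁ f) (freqProj χ l₂ g))
            (C * μ * ‖freqProj χ l₁ f‖ * ‖freqProj χ l₂ g‖))) := by
  obtain ⟨C, hC, h⟩ := lemma4p2_general χ K
  refine ⟨C, hC, fun μ l₁ l₂ _ _ _ hμ h₁ h₂ j f g => ?_⟩
  obtain ⟨hε, hlow⟩ := h m μ l₁ l₂ hμ h₁ h₂ j f g
  exact ⟨⟨fun _ => (hε 1 (.inl rfl)).1, fun _ hl => hlow hl.1⟩,
    fun _ => (hε (-1) (.inr rfl)).1, fun _ _ => (hε (-1) (.inr rfl)).2⟩
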